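/- **Patterns.** Let $\Sigma$ be a finite nonempty alphabet and $X=\{x_1,x_2,\dots\}$ an infinite set of variables. A terminal-free pattern is a nonempty string $\alpha=y_1\cdots y_n$ over $X$; $\mathrm{var}(\alpha)$ is the set of its variables, $|\alpha|_x$ the number of occurrences of $x$, and $L(\alpha)=\{\sigma(\alpha)\mid\sigma:X^*\to\Sigma^*\text{ a morphism}\}$ (variables may be erased). The variable distance $\mathrm{vd}(\alpha)$ is the smallest $k\ge 0$ such that $|\mathrm{var}(\gamma)|\le k$ for every $x\in\mathrm{var}(\alpha)$ and every factorisation $\alpha=\beta\cdot x\cdot\gamma\cdot x\cdot\delta$ with $|\gamma|_x=0$. **Janus automata.** A Janus automaton with $k$ counters, $\mathrm{JFA}(k)$, has a finite set $Q$ of states, an initial state, a set of accepting states and a transition function which assigns to a state, the two symbols scanned by the heads and $k$ counter messages in $\{t_<,t_=\}$ a new state, two head instructions in $\{-1,0,1\}$ and $k$ counter instructions in $\{0,1,r\}$. On an input $\text{¢}w\$$ with $|w|=n$, a configuration consists of a state, head positions $0\le h_1\le h_2\le n+1$, and pairs $(c_i,C_i)$, $0\le c_i\le C_i\le n$, of a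 value and a bound for each counter. The message of counter $i$ is $t_<$ if $c_i<C_i$ and $t_=$ if $c_i=C_i$. In a move, both head instructions are carried out if $0\le h_1+r_1\le h_2+r_2\le n+1$, and otherwise neither head moves; instruction $d_i\in\{0,1\}$ replaces $c_i$ by $(c_i+d_i)\bmod(C_i+1)$; instruction $r$ sets $c_i$ to $0$ and $C_i$ to a nondeterministically chosen number in $\{0,\dots,n\}$. The initial configuration has both heads at position $0$ and all counter values and bounds $0$; $w$ is in $L(M)$ if an accepting state is reachable. **Janus operating modes.** A matching order for $x\in\mathrm{var}(\alpha)$ is a sequence of $|\alpha|_x-1$ pairs $(l,r)$, $l<r$, of positions of $x$ in $\alpha$ that form the edges of a connected graph on the set of all positions of $x$. A complete matching order for $\alpha$ is a sequence $((l_1,r_1),\dots,(l_k,r_k))$ of length $k=\sum_{x\in\mathrm{var}(\alpha)}(|\alpha|_x-1)$ that contains all pairs of some matching order for every $x\in\mathrm{var}(\alpha)$. Let $l_0=r_0=0$, let $g(j,j')=(j+1,\dots,j'-1)$ if $j<j'$ and $g(j,j')=(j,j-1,\dots,j')$ if $j\ge j'$. A Janus operating mode for $\alpha$ derived from this complete matching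 order is a tuple $\Delta=(D_1,\dots,D_k)$, where $D_i$ is obtained by appending $(r_i,\rho),(l_i,\lambda)$ to an interleaving $D_i'$ of the sequence $g(l_{i-1},l_i)$, marked with $\lambda$, and the sequence $g(r_{i-1},r_i)$, marked with $\rho$, such that, whenever both marks occur in $D_i'$, in every nonempty prefix of $D'_i$ the last element marked $\lambda$ is at most the last element marked $\rho$ (if a mark does not occur in the prefix, the first element of $D_i'$ with this mark is taken). Let $D_\alpha=z_1\cdots z_{k'}$ be the word of the variables at the positions listed in $D_1,D_2,\dots,D_k$. The counter number $\mathrm{cn}(\Delta)$ is the maximum over $i$ of the number of variables different from $z_i$ that occur both in $z_1\cdots z_{i-1}$ and in $z_{i+1}\cdots z_{k'}$. **Automata obtained from $\Delta$.** Let $\mathrm{co}:X\to\{1,\dots,\pi\}$ be a map with $\mathrm{co}(x)\ne\mathrm{co}(z)$ whenever $x\neq z$ and $D_\alpha$ has a factorisation $\beta\cdot x\cdot\gamma\cdot z\cdot\gamma'\cdot x\cdot\delta$. The $\mathrm{JFA}(\pi)$ obtained from $\Delta$ and $\mathrm{co}$ first resets all counters and places both heads on the first input symbol. It then goes through $D_1,\dots,D_k$.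 For each entry $(q,\mu)$ of $D'_i$ it moves the left head ($\mu=\lambda$) or the right head ($\mu=\rho$) as many steps as the bound of counter $\mathrm{co}(y_q)$ says, to the right if $l_{i-1}<l_i$ (respectively $r_{i-1}<r_i$) and to the left otherwise. For the last two entries $(r_i,\rho),(l_i,\lambda)$ of $D_i$ it moves both heads that many steps to the right, with the counter $\mathrm{co}(y_{l_i})$, and checks in each step that they scan the same letter; if $r_i=|\alpha|$, the right head must scan $\$$ afterwards. A head that scans $\$$ is not moved to the right, a head that scans ¢ is not moved to the left, and if one of the checks fails, the automaton is stuck. The counter in use is incremented in each step; when it has reached its bound, one further increment sets it to $0$, or, if its variable is not needed any more, it is reset. After $D_k$ the automaton accepts. **Theorem.** Let $\alpha$ be a terminal-free pattern. 1. There is a $\mathrm{JFA}(\mathrm{vd}(\alpha)+1)$ $M$ with $L(M)=L(\alpha)$. 2. Suppose that every variable of $\alpha$ occurs at least twice in $\alpha$. Then $\mathrm{cn}(\Delta)\ge\mathrm{vd}(\alpha)$ for every Janus operating mode $\Delta$ for $\alpha$. Moreover, $M$ in 1. can be chosen as an automaton obtained from a Janus operating mode $\Delta$ for $\alpha$ with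 $\mathrm{cn}(\Delta)=\mathrm{vd}(\alpha)$, and then its number of counters is smallest possible: every Janus automaton that is obtained from a Janus operating mode for $\alpha$ has at least $\mathrm{vd}(\alpha)+1$ counters. -/

import Mathlib

namespace Janus

/-! ### Terminal-free patterns, their languages, and the variable distance

The variables `x₁, x₂, …` are represented by natural numbers; a terminal-free pattern is a nonempty
list of variables. -/

/-- The language of all words `σ(α)`, where the morphism `σ` maps every variable to an arbitrary
(possibly empty) word over `A`. -/
def patternLanguage (A : Type*) (α : List ℕ) : Set (List A) :=
  {w | ∃ σ : ℕ → List A, w = α.flatMap σ}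

/-- The variable distance: the smallest `k` such that any two consecutive occurrences of the same
variable are separated by at most `k` different variables. -/
noncomputable def variableDistance (α : List ℕ) : ℕ :=
  sInf {k | ∀ x ∈ α, ∀ β γ δ : List ℕ,
    α = β ++ [x] ++ γ ++ [x] ++ δ → x ∉ γ → γ.toFinset.card ≤ k}

/-! ### Janus automata -/

/-- The symbols on the tape `¢ w $`. -/
inductive TapeSymbol (A : Type*) where
  | leftEnd : TapeSymbol A
  | letter (a : A) : TapeSymbol A
  | rightEnd : TapeSymbol A

/-- Counter messages: `lt` if the counter value is below the counter bound, `eq` if it equals it. -/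
inductive CounterMessage where
  | lt
  | eq

/-- Counter instructions: leave unchanged, increment, reset. -/
inductive CounterInstruction where
  | keep
  | incr
  | reset

/-- A value of the transition function. The head instructions `-1, 0, 1` are the three elements of
`SignType`. -/
structure Action (Q : Type) (k : ℕ) where
  state : Q
  moveLeftHead : SignType
  moveRightHead : SignType
  counters : Fin k → CounterInstruction

/-- A Janus automaton with `k` counters and input alphabet `A`. The heads may scan endmarkers. -/
structure Automaton (A : Type*) (k : ℕ) where
  Q : Type
  finite_Q : Finite Q
  start : Q
  accept : Set Q
  δ : Q → TapeSymbol A → TapeSymbol A → (Fin k → CounterMessage) → Action Q k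

/-- A configuration: the state, both head positions, and the counter values and bounds. The
constraints `0 ≤ h₁ ≤ h₂ ≤ |w| + 1` and `cᵢ ≤ Cᵢ ≤ |w|` hold for the initial configuration and are
preserved by every move. -/
structure Configuration (Q : Type) (k : ℕ) where
  state : Q
  h₁ : ℕ
  h₂ : ℕ
  value : Fin k → ℕ
  bound : Fin k → ℕ

/-- The symbol at position `h` of the tape `¢ w $`, where `0 ≤ h ≤ |w| + 1`. -/
def scanned {A : Type*} (w : List A) (h : ℕ) : TapeSymbol A :=
  if h = 0 then .leftEnd
  else
    match w[h - 1]? with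
    | some a => .letter a
    | none => .rightEnd

/-- The new head positions on a tape with a word of length `n`: the instructions are carried out
unless a head would leave the tape or the left head would overtake the right head. -/
def moveHeads (n h₁ h₂ : ℕ) (r₁ r₂ : SignType) : ℕ × ℕ :=
  if 0 ≤ (h₁ : ℤ) + (r₁ : ℤ) ∧ (h₁ : ℤ) + (r₁ : ℤ) ≤ (h₂ : ℤ) + (r₂ : ℤ) ∧
      (h₂ : ℤ) + (r₂ : ℤ) ≤ (n : ℤ) + 1 then
    (((h₁ : ℤ) + (r₁ : ℤ)).toNat, ((h₂ : ℤ) + (r₂ : ℤ)).toNat)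
  else (h₁, h₂)

/-- The effect of an instruction on a counter `(c, C)`, the result being `(c', C')`; a reset
guesses an arbitrary new bound of at most `n`. -/
def CounterStep (n : ℕ) (d : CounterInstruction) (c C c' C' : ℕ) : Prop :=
  match d with
  | .keep => C' = C ∧ c' = (c + 0) % (C + 1)
  | .incr => C' = C ∧ c' = (c + 1) % (C + 1)
  | .reset => C' ≤ n ∧ c' = 0

namespace Automaton

variable {A : Type*} {k : ℕ}

/-- The action of `M` in a configuration. -/
def action (M : Automaton A k) (w : List A) (K : Configuration M.Q k) : Action M.Q k :=
  M.δ K.state (scanned w K.h₁) (scanned w K.h₂)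
    (fun j => if K.value j < K.bound j then .lt else .eq)

/-- The atomic move relation of `M` on input `¢ w $`. -/
def Move (M : Automaton A k) (w : List A) (K K' : Configuration M.Q k) : Prop :=
  K'.state = (M.action w K).state ∧
  (K'.h₁, K'.h₂) =
    moveHeads w.length K.h₁ K.h₂ (M.action w K).moveLeftHead (M.action w K).moveRightHead ∧
  ∀ j, CounterStep w.length ((M.action w K).counters j)
    (K.value j) (K.bound j) (K'.value j) (K'.bound j)

/-- The initial configuration. -/
def initial (M : Automaton A k) : Configuration M.Q k :=
  ⟨M.start, 0, 0, fun _ => 0, fun _ => 0⟩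

/-- The language accepted by `M`. -/
def language (M : Automaton A k) : Set (List A) :=
  {w | ∃ K : Configuration M.Q k,
    Relation.ReflTransGen (M.Move w) M.initial K ∧ K.state ∈ M.accept}

end Automaton

/-! ### Matching orders

Positions of a pattern `α = y₁ ⋯ yₙ` are numbered from `1`. -/

/-- The variable `y_q` at position `q`, where `1 ≤ q ≤ |α|`. -/
def varAt (α : List ℕ) (q : ℕ) : ℕ := α.getD (q - 1) 0

/-- The set of positions at which the variable `x` occurs in `α`. -/
def varpos (α : List ℕ) (x : ℕ) : Set ℕ :=
  {q | 1 ≤ q ∧ q ≤ α.length ∧ varAt α q = x}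

/-- `ms` is a matching order for the variable `x` in `α`: a list of `|α|_x - 1` pairs `(l, r)`,
`l < r`, of positions of `x` that are the edges of a connected graph on all positions of `x`. -/
def IsMatchingOrder (α : List ℕ) (x : ℕ) (ms : List (ℕ × ℕ)) : Prop :=
  ms.length = α.count x - 1 ∧
  (∀ m ∈ ms, m.1 ∈ varpos α x ∧ m.2 ∈ varpos α x ∧ m.1 < m.2) ∧
  (SimpleGraph.fromRel (fun a b : varpos α x => (a.1, b.1) ∈ ms)).Connected

/-- `ms` is a complete matching order for `α`. -/
def IsCompleteMatchingOrder (α : List ℕ) (ms : List (ℕ × ℕ)) : Prop :=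
  ms.length = ∑ x ∈ α.toFinset, (α.count x - 1) ∧
  ∃ o : ℕ → List (ℕ × ℕ), ∀ x ∈ α, IsMatchingOrder α x (o x) ∧ ∀ m ∈ o x, m ∈ ms

/-! ### Janus operating modes -/

/-- The markers `λ` (left head) and `ρ` (right head). -/
inductive Head where
  | left
  | right
  deriving DecidableEq

/-- The factors that a head has to pass in order to get from the end of factor `j` to the start of
factor `j'`: `j + 1, …, j' - 1` if `j < j'`, and `j, j - 1, …, j'` if `j' ≤ j`. -/
def passed (j j' : ℕ) : List ℕ :=
  if j < j' then List.range' (j + 1) (j' - j - 1)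
  else (List.range' j' (j - j' + 1)).reverse

/-- The `i`-th matching position (counted from `0`). -/
def matchingPos (ms : List (ℕ × ℕ)) (i : ℕ) : ℕ × ℕ := ms.getD i (0, 0)

/-- The matching position before the `i`-th one, which is `(0, 0)` for the first one. -/
def previousPos (ms : List (ℕ × ℕ)) (i : ℕ) : ℕ × ℕ := ((0, 0) :: ms).getD i (0, 0)

/-- The elements of `D` that carry the marker `μ`, without their marker. -/
def track (μ : Head) (D : List (ℕ × Head)) : List ℕ :=
  (D.filter (fun e => e.2 = μ)).map Prod.fst

/-- The last entry with marker `μ` among the first `j` entries of `D`; if there is none, the first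
entry of `D` with marker `μ` (if any). -/
def headEntry (μ : Head) (D : List (ℕ × Head)) (j : ℕ) : Option ℕ :=
  (track μ (D.take j)).getLast?.or (track μ D).head?

/-- `D` interleaves the moves of the left head from `m.1` to `m'.1` and those of the right head
from `m.2` to `m'.2`, such that the left head never overtakes the right head. -/
def IsInterleaving (m m' : ℕ × ℕ) (D : List (ℕ × Head)) : Prop :=
  track .left D = passed m.1 m'.1 ∧
  track .right D = passed m.2 m'.2 ∧
  ∀ j, 1 ≤ j → j ≤ D.length →
    ∀ a ∈ headEntry .left D j, ∀ b ∈ headEntry .right D j, a ≤ b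

/-- `Δ = (D₁, …, D_k)` is a Janus operating mode for `α` derived from the complete matching
order `ms`. -/
def IsOperatingMode (α : List ℕ) (ms : List (ℕ × ℕ)) (Δ : List (List (ℕ × Head))) : Prop :=
  IsCompleteMatchingOrder α ms ∧ Δ.length = ms.length ∧
  ∀ i < ms.length, ∃ D : List (ℕ × Head),
    IsInterleaving (previousPos ms i) (matchingPos ms i) D ∧
    Δ[i]? = some (D ++ [((matchingPos ms i).2, .right), ((matchingPos ms i).1, .left)])

/-- The word of variables `D_α` read along the head movement indicator of `Δ`. -/
def movementWord (α : List ℕ) (Δ : List (List (ℕ × Head))) : List ℕ :=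
  Δ.flatten.map (fun e => varAt α e.1)

/-- The counter number of `Δ`: the maximum over all entries of the head movement indicator of the
number of variables that occur both before and after this entry and differ from its variable. -/
noncomputable def counterNumber (α : List ℕ) (Δ : List (List (ℕ × Head))) : ℕ :=
  (Finset.range (movementWord α Δ).length).sup fun i =>
    {x | ∃ j j', j < i ∧ i < j' ∧ (movementWord α Δ)[j]? = some x ∧
      (movementWord α Δ)[j']? = some x ∧ (movementWord α Δ)[i]? ≠ some x}.ncard

/-! ### The automata obtained from Janus operating modes -/

/-- An admissible assignment of counters to variables: variables `x ≠ z` such that `x` occurs both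
before and after an occurrence of `z` in the movement word have different counters. -/
def IsCounterAssignment (α : List ℕ) (Δ : List (List (ℕ × Head))) {k : ℕ} (co : ℕ → Fin k) :
    Prop :=
  ∀ x z, x ≠ z →
    (∃ β γ γ' δ : List ℕ, movementWord α Δ = β ++ [x] ++ γ ++ [z] ++ γ' ++ [x] ++ δ) →
    co x ≠ co z

/-- The tasks of the non-initial, non-accepting states: moving a head over factor `q` to the right
(`forth`) or to the left (`back`), or matching the factors `l` and `r`. -/
inductive Task where
  | forth (μ : Head) (q : ℕ)
  | back (μ : Head) (q : ℕ)
  | compare (l r : ℕ)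

/-- The variable whose counter is used for a task. -/
def Task.var (α : List ℕ) : Task → ℕ
  | .forth _ q => varAt α q
  | .back _ q => varAt α q
  | .compare l _ => varAt α l

/-- The task for an entry of `D` when the heads are moved from `m` to `m'`. -/
def moveTask (m m' : ℕ × ℕ) : ℕ × Head → Task
  | (q, .left) => if m.1 < m'.1 then .forth .left q else .back .left q
  | (q, .right) => if m.2 < m'.2 then .forth .right q else .back .right q

/-- The tasks for `D_i`; the last two entries `(r, ρ), (l, λ)` become a single matching task. -/
def tasksOf (m m' : ℕ × ℕ) (D : List (ℕ × Head)) : List Task :=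
  (D.take (D.length - 2)).map (moveTask m m') ++ [.compare m'.1 m'.2]

/-- The sequence of all tasks. -/
def tasks (ms : List (ℕ × ℕ)) (Δ : List (List (ℕ × Head))) : List Task :=
  (List.range ms.length).flatMap fun i =>
    tasksOf (previousPos ms i) (matchingPos ms i) (Δ.getD i [])

/-- Whether a step of a task that is not yet finished is possible for the scanned symbols, and the
resulting head instructions. -/
def Task.advance {A : Type*} [DecidableEq A] :
    Task → TapeSymbol A → TapeSymbol A → Option (SignType × SignType)
  | .forth .left _, .letter _, _ => some (1, 0)
  | .forth .right _, _, .letter _ => some (0, 1)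
  | .back .left _, .letter _, _ => some (-1, 0)
  | .back .left _, .rightEnd, _ => some (-1, 0)
  | .back .right _, _, .letter _ => some (0, -1)
  | .back .right _, _, .rightEnd => some (0, -1)
  | .compare _ _, .letter a, .letter b => if a = b then some (1, 1) else none
  | _, _, _ => none

/-- Whether a finished task may be left: after matching the last factor of a factorisation into
`n` factors, the right head has to scan the right endmarker. -/
def Task.mayLeave {A : Type*} (n : ℕ) : Task → TapeSymbol A → Bool
  | .compare _ r, .letter _ => r ≠ n
  | .compare _ r, .leftEnd => r ≠ n
  | _, _ => true

/-- The Janus automaton obtained from a Janus operating mode with `N` tasks and an assignment `co`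
of counters. State `0` is initial, state `t + 1` performs the task number `t` (counted from `0`),
and state `N + 1` is accepting. Wherever no transition is needed the automaton is stuck, that is, it
changes nothing.
* First, all counters are reset and both heads are moved to the first symbol of the input.
* During a task the counter of its variable is incremented in every step. When the counter has
  reached its bound, it is set back to `0` and the next state is entered; if no later task belongs
  to the same variable, then the counter is reset, so that its bound can be used for another
  variable. -/
def automatonOf (A : Type*) [DecidableEq A] (α : List ℕ) (ms : List (ℕ × ℕ))
    (Δ : List (List (ℕ × Head))) {k : ℕ} (co : ℕ → Fin k) : Automaton A k where
  Q := Fin ((tasks ms Δ).length + 2)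
  finite_Q := inferInstance
  start := 0
  accept := {Fin.last _}
  δ := fun p a b s =>
    let stuck : Action (Fin ((tasks ms Δ).length + 2)) k := ⟨p, 0, 0, fun _ => .keep⟩
    if p = 0 then
      match a, b with
      | .leftEnd, .leftEnd => ⟨p + 1, 1, 1, fun _ => .reset⟩
      | _, _ => stuck
    else
      match (tasks ms Δ)[p.val - 1]? with
      | none => stuck
      | some task =>
        let c := co (task.var α)
        match s c with
        | .lt =>
          match task.advance a b with
          | some (r₁, r₂) => ⟨p, r₁, r₂, fun j => if j = c then .incr else .keep⟩
          | none => stuck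
        | .eq =>
          if task.mayLeave α.length b then
            ⟨p + 1, 0, 0, fun j =>
              if j = c then
                if task.var α ∈ ((tasks ms Δ).drop p.val).map (Task.var α) then .incr else .reset
              else .keep⟩
          else stuck

/-- `M` is one of the automata obtained from the Janus operating mode `Δ` (derived from `ms`). -/
def Automaton.IsObtainedFrom {A : Type*} [DecidableEq A] {k : ℕ} (M : Automaton A k)
    (α : List ℕ) (ms : List (ℕ × ℕ)) (Δ : List (List (ℕ × Head))) : Prop :=
  ∃ co : ℕ → Fin k, IsCounterAssignment α Δ co ∧ M = automatonOf A α ms Δ co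

end Janus

/-!
If some variable occurs only once in `α`, it can be mapped to any word while all others are erased,
so `L(α)` contains every word and a trivial automaton suffices. Otherwise everything rests on an
analysis of the movement word `W` of an operating mode. A variable is active at an entry of `W` if
it occurs both before and after it and differs from the variable there (`activeAt`); the counter
number is the largest number of active variables.

*Lower bound.* The positions of each head form a walk with steps of length at most one, so a head
that gets from one side of a factor to the other visits it (`mem_of_isChain_of_between`). Take two
consecutive occurrences `p < q` of `x` with as many variables in between as the variable distance
allows. Since a matching order is connected, some matching `(l, r)` for `x` satisfies `l ≤ p` and
`q ≤ r`, and at that moment the gap lies between the heads. It follows that the ranges of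
occurrences in `W` of any two variables in `{x}` and the gap intersect, hence by Helly's theorem on
the line all of them contain a common entry (`exists_card_le_ncard_activeAt`). Active variables and
the current one have pairwise different counters (`IsCounterAssignment.counterNumber_lt`), so the
bound carries over to the number of counters.

*Upper bound.* The canonical mode matches consecutive occurrences in the order of their right
components. In each round the left head goes towards its goal through the factors the right head
has passed already, next the right head moves, and the left head completes its way at the end. At
every moment there is a pair of consecutive occurrences of one variable such that the past lies at
or before its right component and the future at or after its left component (`exists_window`). The
active variables and the current one therefore all occur in this window, which contains at most
`vd(α) + 1` variables. As the conflicts between variables form an interval graph, `vd(α) + 1`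
counters suffice (`exists_counterAssignment`).

*Language.* Reading an accepting run backwards, the bound of a counter at any moment is the length
of the factor for the variable that uses this counter next; conversely these bounds can be guessed
(`mem_language_automatonOf_iff`). In the canonical mode the heads always stand between two factors
at the beginning of a task and the left head never overtakes the right one, so that no move is
blocked (`FactorStep`, `perform_iff`). The comparisons then say that consecutive occurrences of each
variable carry equal factors and that the last factor ends at the end of the word, that is, that
the word belongs to `L(α)`.
-/

namespace Janus

/-! ### Movement indicators as walks -/

/-- Discrete intermediate value theorem: a list of numbers whose consecutive entries differ by at
most one contains every number between its first and its last entry. -/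
theorem mem_of_isChain_of_between {L : List ℕ}
    (hL : L.IsChain fun a b => a ≤ b + 1 ∧ b ≤ a + 1) {a b g : ℕ}
    (ha : L.head? = some a) (hb : L.getLast? = some b)
    (h : (a ≤ g ∧ g ≤ b) ∨ (b ≤ g ∧ g ≤ a)) : g ∈ L := by
  induction L generalizing a with
  | nil => simp at ha
  | cons c L ih =>
    simp only [List.head?_cons, Option.some.injEq] at ha
    subst ha
    by_cases hg : g = c
    · simp [hg]
    cases L with
    | nil =>
      simp only [List.getLast?_singleton, Option.some.injEq] at hb
      omega
    | cons d L =>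
      rw [List.isChain_cons_cons] at hL
      refine List.mem_cons_of_mem _ (ih hL.2 (a := d) rfl (by simpa using hb) ?_)
      omega

/-- The positions visited on the way from `a` to `b`, including the final visit of `b`, form a
walk. -/
theorem isChain_passed (a b : ℕ) :
    (a :: (passed a b ++ [b])).IsChain fun a b => a ≤ b + 1 ∧ b ≤ a + 1 := by
  unfold passed
  split_ifs with h
  · have : a :: (List.range' (a + 1) (b - a - 1) ++ [b]) = List.range' a (b - a + 1) := by
      obtain ⟨n, rfl⟩ : ∃ n, b = a + 1 + n := ⟨b - a - 1, by omega⟩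
      rw [show a + 1 + n - a - 1 = n by omega, show a + 1 + n - a + 1 = n + 1 + 1 by omega,
        List.range'_succ, List.range'_1_concat]
    rw [this]
    exact (List.isChain_range' _ _ 1).imp fun x y h => by omega
  · obtain ⟨n, rfl⟩ : ∃ n, a = b + n := ⟨a - b, by omega⟩
    rw [show b + n - b + 1 = n + 1 by omega]
    have h1 : ((List.range' b (n + 1)).reverse ++ [b]).IsChain
        fun a b => a ≤ b + 1 ∧ b ≤ a + 1 := by
      rw [List.isChain_append]
      refine ⟨?_, by simp, ?_⟩
      · rw [List.isChain_reverse]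
        exact (List.isChain_range' _ _ 1).imp fun x y h => by omega
      · intro x hx y hy
        simp [List.range'_succ] at hx hy
        omega
    rw [List.isChain_cons]
    refine ⟨?_, h1⟩
    intro y hy
    rw [List.range'_1_concat] at hy
    simp at hy
    omega

/-- The component of a matching position that belongs to the head `μ`. -/
def Head.pos : Head → ℕ × ℕ → ℕ
  | .left, m => m.1
  | .right, m => m.2

theorem track_append (μ : Head) (D D' : List (ℕ × Head)) :
    track μ (D ++ D') = track μ D ++ track μ D' := by
  simp [track]

theorem mem_track {μ : Head} {D : List (ℕ × Head)} {q : ℕ} : q ∈ track μ D ↔ (q, μ) ∈ D := by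
  simp [track]

theorem track_infix (μ : Head) {D D' : List (ℕ × Head)} (h : D <:+: D') :
    track μ D <:+: track μ D' := (h.filter _).map _

theorem previousPos_zero (ms : List (ℕ × ℕ)) : previousPos ms 0 = (0, 0) := rfl

theorem previousPos_succ (ms : List (ℕ × ℕ)) (i : ℕ) :
    previousPos ms (i + 1) = matchingPos ms i := rfl

theorem track_block {m m' : ℕ × ℕ} {D : List (ℕ × Head)} (h : IsInterleaving m m' D) (μ : Head) :
    track μ (D ++ [(m'.2, .right), (m'.1, .left)]) =
      passed (μ.pos m) (μ.pos m') ++ [μ.pos m'] := by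
  rw [track_append]
  cases μ
  · rw [h.1]; simp [track, Head.pos]
  · rw [h.2.1]; simp [track, Head.pos]

/-- The walk of a head, which starts at `0`. -/
theorem IsOperatingMode.isChain_track {α : List ℕ} {ms : List (ℕ × ℕ)}
    {Δ : List (List (ℕ × Head))} (h : IsOperatingMode α ms Δ) (μ : Head) :
    (0 :: track μ Δ.flatten).IsChain fun a b => a ≤ b + 1 ∧ b ≤ a + 1 := by
  have key : ∀ j ≤ ms.length, ∃ X : List ℕ,
      0 :: track μ (Δ.take j).flatten = X ++ [μ.pos (previousPos ms j)] ∧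
      (0 :: track μ (Δ.take j).flatten).IsChain fun a b => a ≤ b + 1 ∧ b ≤ a + 1 := by
    intro j
    induction j with
    | zero =>
      intro _
      refine ⟨[], ?_, ?_⟩
      · cases μ <;> simp [track, previousPos_zero, Head.pos]
      · simp [track]
    | succ j ih =>
      intro hj
      obtain ⟨X, hX, hc⟩ := ih (by omega)
      obtain ⟨D, hD, hΔ⟩ := h.2.2 j (by omega)
      rw [List.take_add_one, hΔ]
      simp only [Option.toList_some, List.flatten_append, List.flatten_cons, List.flatten_nil,
        List.append_nil, track_append μ (List.take j Δ).flatten, track_block hD μ,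
        previousPos_succ]
      rw [← List.cons_append, hX]
      refine ⟨X ++ [μ.pos (previousPos ms j)] ++
        passed (μ.pos (previousPos ms j)) (μ.pos (matchingPos ms j)), by simp, ?_⟩
      rw [hX] at hc
      exact hc.append_overlap (isChain_passed _ _) (by simp)
  obtain ⟨-, -, hc⟩ := key _ le_rfl
  rwa [← h.2.1, List.take_length] at hc

/-- A head cannot get from one side of a factor to the other without visiting it. -/
theorem IsOperatingMode.exists_visit_between {α : List ℕ} {ms : List (ℕ × ℕ)}
    {Δ : List (List (ℕ × Head))} (h : IsOperatingMode α ms Δ) {μ : Head} {i j a b g : ℕ}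
    (hij : i ≤ j) (hi : Δ.flatten[i]? = some (a, μ)) (hj : Δ.flatten[j]? = some (b, μ))
    (hg : (a ≤ g ∧ g ≤ b) ∨ (b ≤ g ∧ g ≤ a)) :
    ∃ m, i ≤ m ∧ m ≤ j ∧ Δ.flatten[m]? = some (g, μ) := by
  have hc := (List.isChain_cons.1 (h.isChain_track μ)).2
  generalize Δ.flatten = E at *
  set S := (E.take (j + 1)).drop i with hS
  have hjl : j < E.length := (List.getElem?_eq_some_iff.1 hj).1
  have hinf : S <:+: E := (List.drop_suffix _ _).isInfix.trans (List.take_prefix _ _).isInfix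
  have hSget : ∀ n, n ≤ j - i → S[n]? = E[i + n]? := by
    intro n hn
    rw [hS, List.getElem?_drop, List.getElem?_take_of_lt (by omega)]
  have hlen : S.length = j + 1 - i := by simp [hS]; omega
  have h1 : (track μ S).head? = some a := by
    have := hSget 0 (by omega)
    rw [Nat.add_zero, hi] at this
    cases hS' : S with
    | nil => simp [hS'] at this
    | cons e S' =>
      simp [hS'] at this
      simp [track, this]
  have h2 : (track μ S).getLast? = some b := by
    have := hSget (j - i) le_rfl
    rw [show i + (j - i) = j by omega, hj, show j - i = S.length - 1 by omega,
      ← List.getLast?_eq_getElem?] at this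
    obtain ⟨S', hS'⟩ := List.getLast?_eq_some_iff.1 this
    simp [hS', track]
  have := mem_of_isChain_of_between (hc.infix (track_infix μ hinf)) h1 h2 hg
  rw [mem_track, List.mem_iff_getElem?] at this
  obtain ⟨n, hn⟩ := this
  have hnl := (List.getElem?_eq_some_iff.1 hn).1
  exact ⟨i + n, by omega, by omega, by rw [← hSget n (by omega), hn]⟩

/-- Before a head visits a factor, it visits all earlier factors, because it starts at `0`. -/
theorem IsOperatingMode.exists_visit_before {α : List ℕ} {ms : List (ℕ × ℕ)}
    {Δ : List (List (ℕ × Head))} (h : IsOperatingMode α ms Δ) {μ : Head} {j a g : ℕ}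
    (hj : Δ.flatten[j]? = some (a, μ)) (hg : 1 ≤ g) (hga : g ≤ a) :
    ∃ m ≤ j, Δ.flatten[m]? = some (g, μ) := by
  have hc := h.isChain_track μ
  generalize Δ.flatten = E at *
  have hlast : (0 :: track μ (E.take (j + 1))).getLast? = some a := by
    rw [List.take_add_one, hj]
    simp [track, List.getLast?_cons]
  have hinf : (0 :: track μ (E.take (j + 1))) <:+: 0 :: track μ E := by
    have : track μ (E.take (j + 1)) <+: track μ E :=
      ((List.take_prefix _ _).filter _).map _
    exact ((List.prefix_cons_inj 0).2 this).isInfix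
  have := mem_of_isChain_of_between (hc.infix hinf) rfl hlast (Or.inl ⟨Nat.zero_le g, hga⟩)
  rw [List.mem_cons] at this
  rcases this with this | this
  · omega
  rw [mem_track, List.mem_iff_getElem?] at this
  obtain ⟨n, hn⟩ := this
  have hnl := (List.getElem?_eq_some_iff.1 hn).1
  rw [List.length_take] at hnl
  refine ⟨n, by omega, ?_⟩
  rwa [List.getElem?_take_of_lt (by omega)] at hn

/-- Both factors of a matching position are visited immediately after each other. -/
theorem IsOperatingMode.exists_visit_of_mem {α : List ℕ} {ms : List (ℕ × ℕ)}
    {Δ : List (List (ℕ × Head))} (h : IsOperatingMode α ms Δ) {m : ℕ × ℕ} (hm : m ∈ ms) :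
    ∃ t, Δ.flatten[t]? = some (m.2, .right) ∧ Δ.flatten[t + 1]? = some (m.1, .left) := by
  obtain ⟨i, hi⟩ := List.mem_iff_getElem?.1 hm
  have hil := (List.getElem?_eq_some_iff.1 hi).1
  obtain ⟨D, -, hΔ⟩ := h.2.2 i hil
  have hmi : matchingPos ms i = m := by simp [matchingPos, hi]
  rw [hmi] at hΔ
  obtain ⟨s, t, hst⟩ := List.append_of_mem (List.mem_of_getElem? hΔ)
  rw [hst]
  have e : (s ++ (D ++ [(m.2, Head.right), (m.1, Head.left)]) :: t).flatten =
      (s.flatten ++ D) ++ ((m.2, Head.right) :: (m.1, Head.left) :: t.flatten) := by simp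
  rw [e]
  refine ⟨(s.flatten ++ D).length, ?_, ?_⟩
  · rw [List.getElem?_append_right le_rfl]; simp
  · rw [List.getElem?_append_right (by omega)]; simp

/-! ### Matching orders and gaps -/

/-- A matching order contains a pair that crosses any gap between two positions of its variable. -/
theorem IsMatchingOrder.exists_crossing {α : List ℕ} {x : ℕ} {ms : List (ℕ × ℕ)}
    (h : IsMatchingOrder α x ms) {p q : ℕ} (hp : p ∈ varpos α x) (hq : q ∈ varpos α x)
    (hpq : p < q) (hgap : ∀ g ∈ varpos α x, g ≤ p ∨ q ≤ g) :
    ∃ m ∈ ms, m.1 ≤ p ∧ q ≤ m.2 := by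
  obtain ⟨w⟩ := h.2.2.preconnected ⟨p, hp⟩ ⟨q, hq⟩
  obtain ⟨d, -, h1, h2⟩ := w.exists_boundary_dart {a | a.1 ≤ p} (by simp)
    (by simpa using hpq)
  have hadj := d.adj
  rw [SimpleGraph.fromRel_adj] at hadj
  simp only [Set.mem_ofPred_eq, not_le] at h1 h2
  have h3 := (hgap _ d.snd.2).resolve_left (by omega)
  rcases hadj.2 with hm | hm
  · exact ⟨_, hm, h1, h3⟩
  · have := (h.2.1 _ hm).2.2
    simp only at this
    omega

theorem IsCompleteMatchingOrder.exists_mem {α : List ℕ} {ms : List (ℕ × ℕ)}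
    (h : IsCompleteMatchingOrder α ms) {x : ℕ} (hx : 2 ≤ α.count x) :
    ∃ m ∈ ms, m.1 ∈ varpos α x := by
  obtain ⟨-, o, ho⟩ := h
  obtain ⟨⟨h1, h2, -⟩, h3⟩ := ho x (List.count_pos_iff.1 (by omega))
  obtain ⟨m, hm⟩ := List.exists_mem_of_length_pos (l := o x) (by omega)
  exact ⟨m, h3 m hm, (h2 m hm).1⟩

/-! ### The counter number -/

/-- The variables other than the `i`-th one that occur both before and after position `i`. -/
def activeAt (W : List ℕ) (i : ℕ) : Set ℕ :=
  {x | ∃ j j', j < i ∧ i < j' ∧ W[j]? = some x ∧ W[j']? = some x ∧ W[i]? ≠ some x}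

theorem activeAt_subset (W : List ℕ) (i : ℕ) : activeAt W i ⊆ W.toFinset := by
  rintro x ⟨j, -, -, -, h, -⟩
  simpa using List.mem_of_getElem? h

theorem finite_activeAt (W : List ℕ) (i : ℕ) : (activeAt W i).Finite :=
  W.toFinset.finite_toSet.subset (activeAt_subset W i)

theorem counterNumber_eq (α : List ℕ) (Δ : List (List (ℕ × Head))) :
    counterNumber α Δ = (Finset.range (movementWord α Δ).length).sup fun i =>
      (activeAt (movementWord α Δ) i).ncard := rfl

/-- A Helly argument: if the occurrence ranges of the variables in `V` intersect pairwise, then at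
the variable of `V` that is the last one to start, all others are active. -/
theorem exists_card_le_ncard_activeAt {W : List ℕ} {V : Finset ℕ} (hV : V.Nonempty)
    (hmem : ∀ y ∈ V, y ∈ W)
    (h : ∀ y ∈ V, ∀ y' ∈ V, y ≠ y' → ∃ i j : ℕ, i ≤ j ∧ W[i]? = some y' ∧ W[j]? = some y) :
    ∃ i < W.length, V.card ≤ (activeAt W i).ncard + 1 := by
  obtain ⟨z, hz, hmax⟩ := V.exists_max_image W.idxOf hV
  have hidx : ∀ y ∈ V, W[W.idxOf y]? = some y := fun y hy =>
    List.getElem?_idxOf (hmem y hy)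
  refine ⟨W.idxOf z, List.idxOf_lt_length_of_mem (hmem z hz), ?_⟩
  have hsub : ((V.erase z : Finset ℕ) : Set ℕ) ⊆ activeAt W (W.idxOf z) := by
    intro y hy
    simp only [Finset.coe_erase, Set.mem_sdiff, Finset.mem_coe, Set.mem_singleton_iff] at hy
    obtain ⟨i, j, hij, hi, hj⟩ := h y hy.1 z hz hy.2
    have h1 : W.idxOf y ≠ W.idxOf z := fun e => by
      have := hidx y hy.1
      rw [e, hidx z hz] at this
      exact hy.2 (by simpa using this.symm)
    have h2 : W.idxOf z ≤ i := by
      by_contra hlt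
      push Not at hlt
      have := List.not_of_lt_findIdx (p := (· == z)) (xs := W) (i := i) hlt
      rw [List.getElem?_eq_some_iff] at hi
      obtain ⟨_, hi⟩ := hi
      simp [hi] at this
    have h3 : i ≠ j := fun e => by
      rw [e, hj] at hi
      exact hy.2 (by simpa using hi)
    refine ⟨W.idxOf y, j, lt_of_le_of_ne (hmax y hy.1) h1, by omega, hidx y hy.1, hj, ?_⟩
    rw [hidx z hz]
    simpa using fun e => hy.2 e.symm
  have := Set.ncard_le_ncard hsub (finite_activeAt W _)
  rw [Set.ncard_coe_finset] at this
  have := Finset.card_erase_add_one hz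
  omega

theorem movementWord_getElem? {α : List ℕ} {Δ : List (List (ℕ × Head))} {i : ℕ}
    {e : ℕ × Head} (h : Δ.flatten[i]? = some e) :
    (movementWord α Δ)[i]? = some (varAt α e.1) := by
  rw [movementWord, List.getElem?_map, h]
  rfl

/-! ### Gaps between consecutive occurrences -/

theorem varAt_append_add {β γ : List ℕ} {i : ℕ} (hi : 1 ≤ i) :
    varAt (β ++ γ) (β.length + i) = varAt γ i := by
  unfold varAt
  rw [List.getD_append_right _ _ _ _ (by omega)]
  congr 1
  omega

theorem varAt_append_left {β γ : List ℕ} {i : ℕ} (hi : 1 ≤ i) (h : i ≤ β.length) :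
    varAt (β ++ γ) i = varAt β i := by
  unfold varAt
  rw [List.getD_append _ _ _ _ (by omega)]

theorem varAt_mem {β : List ℕ} {i : ℕ} (hi : 1 ≤ i) (h : i ≤ β.length) : varAt β i ∈ β := by
  unfold varAt
  rw [List.getD_eq_getElem _ _ (by omega)]
  exact List.getElem_mem _

theorem exists_varAt_of_mem {β : List ℕ} {x : ℕ} (h : x ∈ β) :
    ∃ i, 1 ≤ i ∧ i ≤ β.length ∧ varAt β i = x := by
  obtain ⟨i, hi, rfl⟩ := List.getElem_of_mem h
  refine ⟨i + 1, by omega, by omega, ?_⟩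
  simp [varAt, hi]

theorem variableDistance_spec (α : List ℕ) : ∀ x ∈ α, ∀ β γ δ : List ℕ,
    α = β ++ [x] ++ γ ++ [x] ++ δ → x ∉ γ → γ.toFinset.card ≤ variableDistance α := by
  have : variableDistance α ∈ {k | ∀ x ∈ α, ∀ β γ δ : List ℕ,
      α = β ++ [x] ++ γ ++ [x] ++ δ → x ∉ γ → γ.toFinset.card ≤ k} := by
    refine Nat.sInf_mem ⟨α.length, fun x _ β γ δ h _ => ?_⟩
    refine (List.toFinset_card_le γ).trans ?_
    rw [h]
    simp
    omega
  exact this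

/-- A gap with as many variables as the variable distance allows. -/
theorem exists_gap {α : List ℕ} (h : 0 < variableDistance α) :
    ∃ x p q : ℕ, ∃ V : Finset ℕ, p ∈ varpos α x ∧ q ∈ varpos α x ∧ p < q ∧
      (∀ g ∈ varpos α x, g ≤ p ∨ q ≤ g) ∧ variableDistance α ≤ V.card ∧ x ∉ V ∧
      ∀ y ∈ V, ∃ g ∈ varpos α y, p < g ∧ g < q := by
  have : variableDistance α - 1 ∉ {k | ∀ x ∈ α, ∀ β γ δ : List ℕ,
      α = β ++ [x] ++ γ ++ [x] ++ δ → x ∉ γ → γ.toFinset.card ≤ k} :=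
    Nat.notMem_of_lt_sInf (by unfold variableDistance at h ⊢; omega)
  simp only [Set.mem_ofPred_eq, not_forall, not_le] at this
  obtain ⟨x, -, β, γ, δ, hα, hx, hc⟩ := this
  have e1 : ∀ i, 1 ≤ i → varAt α (β.length + i) = varAt ([x] ++ γ ++ [x] ++ δ) i := by
    intro i hi
    rw [hα, ← varAt_append_add (β := β) hi]
    simp
  have e2 : ∀ i, 1 ≤ i → varAt α (β.length + 1 + i) = varAt (γ ++ [x] ++ δ) i := by
    intro i hi
    rw [add_assoc, e1 _ (by omega), ← varAt_append_add (β := [x]) hi]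
    simp
  have e3 : ∀ i, 1 ≤ i → i ≤ γ.length → varAt α (β.length + 1 + i) = varAt γ i := by
    intro i hi h
    rw [e2 i hi, List.append_assoc, varAt_append_left hi h]
  have hlen : α.length = β.length + 1 + γ.length + 1 + δ.length := by
    rw [hα]; simp only [List.length_append, List.length_singleton]
  refine ⟨x, β.length + 1, β.length + 1 + (γ.length + 1), γ.toFinset,
    ⟨by omega, by omega, ?_⟩, ⟨by omega, by omega, ?_⟩, by omega, ?_, by omega, by simpa, ?_⟩
  · rw [e1 1 le_rfl]; simp [varAt]
  · rw [e2 _ (by omega), List.append_assoc, varAt_append_add le_rfl]; simp [varAt]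
  · rintro g ⟨hg1, -, hg⟩
    by_contra hcon
    push Not at hcon
    obtain ⟨i, rfl⟩ : ∃ i, g = β.length + 1 + i := ⟨g - (β.length + 1), by omega⟩
    rw [e3 i (by omega) (by omega)] at hg
    exact hx (hg ▸ varAt_mem (by omega) (by omega))
  · intro y hy
    obtain ⟨i, h1, h2, h3⟩ := exists_varAt_of_mem (List.mem_toFinset.1 hy)
    exact ⟨β.length + 1 + i, ⟨by omega, by omega, by rw [e3 i h1 h2, h3]⟩, by omega, by omega⟩

/-- The variables in a maximal gap and the variable around it are, up to one of them, active at the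
same time. -/
theorem IsOperatingMode.variableDistance_le_counterNumber {α : List ℕ}
    (hα : ∀ x ∈ α, 2 ≤ α.count x) {ms : List (ℕ × ℕ)} {Δ : List (List (ℕ × Head))}
    (h : IsOperatingMode α ms Δ) : variableDistance α ≤ counterNumber α Δ := by
  rcases Nat.eq_zero_or_pos (variableDistance α) with h0 | h0
  · omega
  obtain ⟨x, p, q, V, hp, hq, hpq, hgap, hcard, hxV, hV⟩ := exists_gap h0
  have hmemα : ∀ {y g}, g ∈ varpos α y → y ∈ α := by
    rintro y g ⟨h1, h2, rfl⟩
    exact varAt_mem h1 h2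
  obtain ⟨m, hm, hml, hmr, hmx⟩ : ∃ m ∈ ms, m.1 ≤ p ∧ q ≤ m.2 ∧ m.1 ∈ varpos α x := by
    obtain ⟨-, o, ho⟩ := h.1
    obtain ⟨h1, h2⟩ := ho x (hmemα hp)
    obtain ⟨m, hm, h3, h4⟩ := h1.exists_crossing hp hq hpq hgap
    exact ⟨m, h2 m hm, h3, h4, (h1.2.1 m hm).1⟩
  -- At time `t + 1` the gap lies between the two heads.
  obtain ⟨t, htr, htl⟩ := h.exists_visit_of_mem hm
  have hright : ∀ g, 1 ≤ g → g ≤ q → ∃ s ≤ t, Δ.flatten[s]? = some (g, .right) :=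
    fun g h1 h2 => h.exists_visit_before htr h1 (h2.trans hmr)
  have key : ∀ {i j : ℕ} {e e' : ℕ × Head} {y y' : ℕ}, i ≤ j →
      Δ.flatten[i]? = some e' → Δ.flatten[j]? = some e →
      e'.1 ∈ varpos α y' → e.1 ∈ varpos α y → ∃ i j : ℕ, i ≤ j ∧
      (movementWord α Δ)[i]? = some y' ∧ (movementWord α Δ)[j]? = some y := by
    intro i j e e' y y' hij hi hj he' he
    refine ⟨i, j, hij, ?_, ?_⟩
    · rw [movementWord_getElem? hi, he'.2.2]
    · rw [movementWord_getElem? hj, he.2.2]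
  have hmem : ∀ y ∈ insert x V, ∃ g ∈ varpos α y, p ≤ g ∧ g ≤ q := by
    intro y hy
    rcases Finset.mem_insert.1 hy with rfl | hy
    · exact ⟨p, hp, le_rfl, hpq.le⟩
    · obtain ⟨g, hg, h1, h2⟩ := hV y hy
      exact ⟨g, hg, h1.le, h2.le⟩
  obtain ⟨i, hi, hle⟩ := exists_card_le_ncard_activeAt (W := movementWord α Δ) (V := insert x V)
    ⟨x, by simp⟩ (fun y hy => by
      obtain ⟨g, hg, h1, h2⟩ := hmem y hy
      obtain ⟨s, -, hs⟩ := hright g hg.1 h2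
      have := movementWord_getElem? (α := α) hs
      rw [hg.2.2] at this
      exact List.mem_of_getElem? this) (by
    intro y hy y' hy' hne
    rcases Finset.mem_insert.1 hy with rfl | hyV
    · obtain ⟨g, hg, h1, h2⟩ := hmem y' hy'
      obtain ⟨s, hst, hs⟩ := hright g hg.1 h2
      exact key (show s ≤ t + 1 by omega) hs htl hg hmx
    obtain ⟨g, hg, h1, h2⟩ := hV y hyV
    obtain ⟨s, hst, hs⟩ := hright g hg.1 h2.le
    obtain ⟨g', hg', h1', h2'⟩ := hmem y' hy'
    obtain ⟨s', hst', hs'⟩ := hright g' hg'.1 h2'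
    obtain ⟨m', hm', hmy⟩ := h.1.exists_mem (hα y' (hmemα hg'))
    obtain ⟨u, -, hu⟩ := h.exists_visit_of_mem hm'
    rcases le_or_gt m'.1 g with hlg | hlg
    · -- The right head has passed the factor `m'.1` before it reaches `g`.
      obtain ⟨s₀, hs₀, hs₀'⟩ := h.exists_visit_before hs hmy.1 hlg
      exact key hs₀ hs₀' hs hmy hg
    · -- The left head crosses `g` between the matchings `m'` and `m`.
      rcases le_total (u + 1) (t + 1) with hut | hut
      · obtain ⟨n, hn, -, hn'⟩ := h.exists_visit_between (g := g) hut hu htl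
          (Or.inr ⟨by omega, by omega⟩)
        exact key hn hu hn' hmy hg
      · obtain ⟨n, hn, -, hn'⟩ := h.exists_visit_between (g := g) hut htl hu
          (Or.inl ⟨by omega, by omega⟩)
        exact key (show s' ≤ n by omega) hs' hn' hg' hg)
  rw [Finset.card_insert_of_notMem hxV] at hle
  have hsup := Finset.le_sup (f := fun i => (activeAt (movementWord α Δ) i).ncard)
    (Finset.mem_range.2 hi)
  rw [← counterNumber_eq] at hsup
  omega

/-! ### Counter assignments -/

theorem exists_factorisation_iff {W : List ℕ} {x z : ℕ} :
    (∃ β γ γ' δ : List ℕ, W = β ++ [x] ++ γ ++ [z] ++ γ' ++ [x] ++ δ) ↔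
      ∃ i j k : ℕ, i < j ∧ j < k ∧ W[i]? = some x ∧ W[j]? = some z ∧ W[k]? = some x := by
  constructor
  · rintro ⟨β, γ, γ', δ, rfl⟩
    refine ⟨β.length, β.length + 1 + γ.length, β.length + 1 + γ.length + 1 + γ'.length,
      by omega, by omega, ?_, ?_, ?_⟩
    · rw [show β ++ [x] ++ γ ++ [z] ++ γ' ++ [x] ++ δ =
        β ++ x :: (γ ++ [z] ++ γ' ++ [x] ++ δ) by simp]
      simp
    · rw [show β ++ [x] ++ γ ++ [z] ++ γ' ++ [x] ++ δ =
        (β ++ [x] ++ γ) ++ z :: (γ' ++ [x] ++ δ) by simp]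
      rw [List.getElem?_append_right (by simp; omega)]
      simp [← add_assoc, add_right_comm _ _ 1]
    · rw [show β ++ [x] ++ γ ++ [z] ++ γ' ++ [x] ++ δ =
        (β ++ [x] ++ γ ++ [z] ++ γ') ++ x :: δ by simp]
      have : (β ++ [x] ++ γ ++ [z] ++ γ').length =
          β.length + 1 + γ.length + 1 + γ'.length := by
        simp only [List.length_append, List.length_singleton]
      rw [← this]
      simp
  · rintro ⟨i, j, k, hij, hjk, hi, hj, hk⟩
    have h1 : x ∈ W.take j :=
      List.mem_of_getElem? (i := i) (by rwa [List.getElem?_take_of_lt hij])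
    have h2 : x ∈ W.drop (j + 1) :=
      List.mem_of_getElem? (i := k - (j + 1))
        (by rwa [List.getElem?_drop, show j + 1 + (k - (j + 1)) = k by omega])
    obtain ⟨hjl, hj⟩ := List.getElem?_eq_some_iff.1 hj
    obtain ⟨β, γ, h1⟩ := List.append_of_mem h1
    obtain ⟨γ', δ, h2⟩ := List.append_of_mem h2
    refine ⟨β, γ, γ', δ, ?_⟩
    have := List.take_append_drop j W
    rw [List.drop_eq_getElem_cons hjl, h1, h2, hj] at this
    rw [← this]
    simp

theorem exists_factorisation_of_sublist {W : List ℕ} {x z : ℕ} (h : [x, z, x].Sublist W) :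
    ∃ β γ γ' δ : List ℕ, W = β ++ [x] ++ γ ++ [z] ++ γ' ++ [x] ++ δ := by
  obtain ⟨r₁, r₂, rfl, h1, h'⟩ := List.cons_sublist_iff.1 h
  obtain ⟨r₃, r₄, rfl, h2, h''⟩ := List.cons_sublist_iff.1 h'
  obtain ⟨β, γ, rfl⟩ := List.append_of_mem h1
  obtain ⟨γ₁, γ₂, rfl⟩ := List.append_of_mem h2
  obtain ⟨γ', δ, rfl⟩ := List.append_of_mem (List.singleton_sublist.1 h'')
  exact ⟨β, γ ++ γ₁, γ₂ ++ γ', δ, by simp⟩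

/-- The variables that are active at an entry and the variable of this entry have pairwise
different counters. -/
theorem IsCounterAssignment.counterNumber_lt {α : List ℕ} {Δ : List (List (ℕ × Head))} {k : ℕ}
    {co : ℕ → Fin k} (h : IsCounterAssignment α Δ co) : counterNumber α Δ + 1 ≤ k := by
  have hk : 0 < k := (co 0).pos
  suffices counterNumber α Δ ≤ k - 1 by omega
  rw [counterNumber_eq]
  refine Finset.sup_le fun i hi => ?_
  rw [Finset.mem_range] at hi
  set W := movementWord α Δ with hW
  have hne : ∀ x z, x ≠ z → (∃ i j l : ℕ, i < j ∧ j < l ∧ W[i]? = some x ∧ W[j]? = some z ∧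
      W[l]? = some x) → co x ≠ co z :=
    fun x z hxz hc => h x z hxz (exists_factorisation_iff.2 hc)
  have hi' : W[i]? = some W[i] := List.getElem?_eq_getElem hi
  have hnot : W[i] ∉ activeAt W i := by
    rintro ⟨_, _, _, _, _, _, hx⟩
    exact hx hi'
  have hact : ∀ x ∈ activeAt W i, co x ≠ co W[i] := by
    rintro x ⟨j, l, hj, hl, hxj, hxl, hx⟩
    exact hne _ _ (fun e => hx (by rw [hi', e])) ⟨j, i, l, hj, hl, hxj, hi', hxl⟩
  have hinj : Set.InjOn co (insert W[i] (activeAt W i)) := by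
    rw [Set.injOn_insert hnot]
    refine ⟨?_, ?_⟩
    · rintro x ⟨j, l, hj, hl, hxj, hxl, -⟩ z ⟨j', l', hj', hl', hzj, hzl, -⟩ hxz
      by_contra hcon
      have hjj : j ≠ j' := fun e => hcon (by rw [e, hzj] at hxj; simpa using hxj.symm)
      rcases lt_or_gt_of_ne hjj with hlt | hlt
      · exact hne x z hcon ⟨j, j', l, hlt, by omega, hxj, hzj, hxl⟩ hxz
      · exact hne z x (Ne.symm hcon) ⟨j', j, l', hlt, by omega, hzj, hxj, hzl⟩ hxz.symm
    · rintro ⟨x, hx, hxz⟩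
      exact hact x hx hxz
  have h1 := hinj.ncard_image
  rw [Set.ncard_insert_of_notMem hnot (finite_activeAt W i)] at h1
  have h2 := Set.ncard_le_card (co '' insert W[i] (activeAt W i))
  rw [Nat.card_eq_fintype_card, Fintype.card_fin] at h2
  omega

/-- Greedy colouring of an interval graph: the variables are coloured in the order of their first
occurrences. -/
theorem exists_counterAssignment (α : List ℕ) (Δ : List (List (ℕ × Head))) {c : ℕ}
    (hc : counterNumber α Δ ≤ c) :
    ∃ co : ℕ → Fin (c + 1), IsCounterAssignment α Δ co := by
  set W := movementWord α Δ with hW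
  have hcard : ∀ i < W.length, (activeAt W i).ncard ≤ c := fun i hi =>
    (Finset.le_sup (f := fun i => (activeAt W i).ncard) (Finset.mem_range.2 hi)).trans hc
  have key : ∀ n ≤ W.length, ∃ co : ℕ → Fin (c + 1), ∀ x ∈ W.take n, ∀ z ∈ W.take n, x ≠ z →
      (∃ i j k : ℕ, i < j ∧ j < k ∧ W[i]? = some x ∧ W[j]? = some z ∧ W[k]? = some x) →
      co x ≠ co z := by
    intro n
    induction n with
    | zero => exact fun _ => ⟨fun _ => 0, by simp⟩
    | succ n ih =>
      intro hn
      obtain ⟨co, hco⟩ := ih (by omega)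
      have htake : W.take (n + 1) = W.take n ++ [W[n]] := by
        rw [List.take_add_one, List.getElem?_eq_getElem (by omega)]
        rfl
      have hn' : W[n]? = some W[n] := List.getElem?_eq_getElem (by omega)
      by_cases hv : W[n] ∈ W.take n
      · refine ⟨co, fun x hx z hz => hco x ?_ z ?_⟩
        · rw [htake] at hx
          simp only [List.mem_append, List.mem_singleton] at hx
          exact hx.elim id (fun e => e ▸ hv)
        · rw [htake] at hz
          simp only [List.mem_append, List.mem_singleton] at hz
          exact hz.elim id (fun e => e ▸ hv)
      obtain ⟨d, hd⟩ : ∃ d, d ∉ co '' activeAt W n := by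
        by_contra hcon
        push Not at hcon
        have h1 := Set.ncard_image_le (f := co) (finite_activeAt W n)
        rw [Set.eq_univ_of_forall hcon, Set.ncard_univ, Nat.card_eq_fintype_card,
          Fintype.card_fin] at h1
        have := hcard n (by omega)
        omega
      have hd' : ∀ x ∈ W.take n, (∃ k, n < k ∧ W[k]? = some x) → co x ≠ d := by
        rintro x hx ⟨k, hk, hxk⟩ rfl
        refine hd ⟨x, ?_, rfl⟩
        obtain ⟨m, hm⟩ := List.mem_iff_getElem?.1 hx
        have hmn : m < n := by
          have := (List.getElem?_eq_some_iff.1 hm).1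
          rw [List.length_take] at this
          omega
        rw [List.getElem?_take_of_lt hmn] at hm
        refine ⟨m, k, hmn, hk, hm, hxk, fun e => hv ?_⟩
        rw [hn', Option.some.injEq] at e
        rwa [e]
      have hfirst : ∀ i, W[i]? = some W[n] → n ≤ i := by
        intro i hi
        by_contra hlt
        exact hv (List.mem_of_getElem? (i := i) (by rwa [List.getElem?_take_of_lt (by omega)]))
      refine ⟨Function.update co W[n] d, ?_⟩
      intro x hx z hz hxz hconf
      rw [htake] at hx hz
      simp only [List.mem_append, List.mem_singleton] at hx hz
      obtain ⟨i, j, k, hij, hjk, hi, hj, hk⟩ := hconf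
      by_cases hxv : x = W[n]
      · have hzv : z ≠ W[n] := fun e => hxz (hxv.trans e.symm)
        rw [hxv, Function.update_self, Function.update_of_ne hzv]
        have := hfirst i (hxv ▸ hi)
        exact (hd' z (hz.resolve_right hzv) ⟨j, by omega, hj⟩).symm
      by_cases hzv : z = W[n]
      · rw [hzv, Function.update_self, Function.update_of_ne hxv]
        have := hfirst j (hzv ▸ hj)
        exact hd' x (hx.resolve_right hxv) ⟨k, by omega, hk⟩
      · rw [Function.update_of_ne hxv, Function.update_of_ne hzv]
        exact hco x (hx.resolve_right hxv) z (hz.resolve_right hzv) hxz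
          ⟨i, j, k, hij, hjk, hi, hj, hk⟩
  obtain ⟨co, hco⟩ := key W.length le_rfl
  rw [List.take_length] at hco
  refine ⟨co, fun x z hxz hfac => ?_⟩
  have hidx := exists_factorisation_iff.1 hfac
  obtain ⟨i, j, k, -, -, hi, hj, -⟩ := hidx
  exact hco x (List.mem_of_getElem? hi) z (List.mem_of_getElem? hj) hxz
    (exists_factorisation_iff.1 hfac)

/-! ### The canonical matching order -/

/-- The position of the previous occurrence of the variable at position `r`, or `0` if `r` is its
first occurrence. -/
def prevOcc (α : List ℕ) (r : ℕ) : ℕ :=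
  Nat.findGreatest (fun q => 1 ≤ q ∧ varAt α q = varAt α r) (r - 1)

theorem prevOcc_lt {α : List ℕ} {r : ℕ} (hr : 1 ≤ r) : prevOcc α r < r := by
  have := Nat.findGreatest_le (P := fun q => 1 ≤ q ∧ varAt α q = varAt α r) (r - 1)
  unfold prevOcc
  omega

theorem varAt_prevOcc {α : List ℕ} {r : ℕ} (h : prevOcc α r ≠ 0) :
    varAt α (prevOcc α r) = varAt α r :=
  (Nat.findGreatest_of_ne_zero (P := fun q => 1 ≤ q ∧ varAt α q = varAt α r) rfl h).2

theorem le_prevOcc {α : List ℕ} {q r : ℕ} (hq : 1 ≤ q) (hqr : q < r)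
    (h : varAt α q = varAt α r) : q ≤ prevOcc α r :=
  Nat.le_findGreatest (by omega) ⟨hq, h⟩

/-- All pairs of consecutive occurrences of a variable, ordered by their right components. -/
def canonicalMatching (α : List ℕ) : List (ℕ × ℕ) :=
  ((List.range' 1 α.length).filter fun r => prevOcc α r ≠ 0).map fun r => (prevOcc α r, r)

theorem mem_canonicalMatching {α : List ℕ} {m : ℕ × ℕ} :
    m ∈ canonicalMatching α ↔
      m.2 ≤ α.length ∧ m.1 = prevOcc α m.2 ∧ 1 ≤ m.1 ∧ m.1 < m.2 := by
  obtain ⟨l, r⟩ := m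
  simp only [canonicalMatching, List.mem_map, List.mem_filter, List.mem_range'_1,
    decide_eq_true_eq, Prod.mk.injEq]
  constructor
  · rintro ⟨r, ⟨h1, h2⟩, rfl, rfl⟩
    have := prevOcc_lt (α := α) h1.1
    omega
  · rintro ⟨h1, h2, h3, h4⟩
    exact ⟨r, by omega, h2.symm, rfl⟩

theorem varAt_eq_of_mem_canonicalMatching {α : List ℕ} {m : ℕ × ℕ}
    (h : m ∈ canonicalMatching α) : varAt α m.1 = varAt α m.2 := by
  obtain ⟨-, h2, h3, -⟩ := mem_canonicalMatching.1 h
  rw [h2]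
  exact varAt_prevOcc (by omega)

theorem matchingPos_mem {ms : List (ℕ × ℕ)} {i : ℕ} (hi : i < ms.length) :
    matchingPos ms i ∈ ms := by
  rw [matchingPos, List.getD_eq_getElem _ _ hi]
  exact List.getElem_mem _

theorem exists_matchingPos_eq {ms : List (ℕ × ℕ)} {m : ℕ × ℕ} (h : m ∈ ms) :
    ∃ i < ms.length, matchingPos ms i = m := by
  obtain ⟨i, hi, rfl⟩ := List.getElem_of_mem h
  exact ⟨i, hi, by rw [matchingPos, List.getD_eq_getElem _ _ hi]⟩

theorem canonicalMatching_strictMono {α : List ℕ} {i j : ℕ} (hij : i < j)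
    (hj : j < (canonicalMatching α).length) :
    (matchingPos (canonicalMatching α) i).2 < (matchingPos (canonicalMatching α) j).2 := by
  have : (canonicalMatching α).Pairwise fun m m' => m.2 < m'.2 := by
    unfold canonicalMatching
    rw [List.pairwise_map]
    exact List.Pairwise.filter _ List.pairwise_lt_range'
  rw [List.pairwise_iff_getElem] at this
  rw [matchingPos, List.getD_eq_getElem _ _ (by omega), matchingPos, List.getD_eq_getElem _ _ hj]
  exact this i j (by omega) hj hij

theorem canonicalMatching_mono {α : List ℕ} {i j : ℕ} (hij : i ≤ j)
    (hj : j < (canonicalMatching α).length) :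
    (matchingPos (canonicalMatching α) i).2 ≤ (matchingPos (canonicalMatching α) j).2 := by
  rcases hij.eq_or_lt with rfl | h
  · exact le_rfl
  · exact (canonicalMatching_strictMono h hj).le

theorem previousPos_canonicalMatching {α : List ℕ} {i : ℕ}
    (hi : i < (canonicalMatching α).length) :
    (previousPos (canonicalMatching α) i).1 ≤ (previousPos (canonicalMatching α) i).2 ∧
    (previousPos (canonicalMatching α) i).2 < (matchingPos (canonicalMatching α) i).2 := by
  cases i with
  | zero =>
    obtain ⟨-, -, h3, h4⟩ := mem_canonicalMatching.1 (matchingPos_mem hi)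
    rw [previousPos_zero]
    exact ⟨le_rfl, by simp only; omega⟩
  | succ i =>
    obtain ⟨-, -, h3, h4⟩ :=
      mem_canonicalMatching.1 (matchingPos_mem (ms := canonicalMatching α) (i := i) (by omega))
    rw [previousPos_succ]
    exact ⟨h4.le, canonicalMatching_strictMono (by omega) hi⟩

theorem map_varAt_range' (α : List ℕ) : (List.range' 1 α.length).map (varAt α) = α := by
  refine List.ext_getElem (by simp) fun i h1 h2 => ?_
  simp [varAt, h2]

theorem count_eq_card (α : List ℕ) (x : ℕ) :
    α.count x = {r ∈ Finset.Icc 1 α.length | varAt α r = x}.card := by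
  have h : {r ∈ Finset.Icc 1 α.length | varAt α r = x} =
      ((List.range' 1 α.length).filter fun r => varAt α r = x).toFinset := by
    ext r
    simp only [Finset.mem_filter, Finset.mem_Icc, List.mem_toFinset, List.mem_filter,
      List.mem_range'_1, decide_eq_true_eq]
    exact and_congr_left fun _ => by omega
  rw [h, List.toFinset_card_of_nodup (List.Nodup.filter _ List.nodup_range'),
    ← List.countP_eq_length_filter]
  conv_lhs => rw [← map_varAt_range' α]
  rw [List.count, List.countP_map]
  congr 1

/-- Every occurrence of a variable but the first one is preceded by another one. -/
theorem card_prevOcc_ne_zero {α : List ℕ} {x : ℕ} (hx : x ∈ α) :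
    {r ∈ Finset.Icc 1 α.length | prevOcc α r ≠ 0 ∧ varAt α r = x}.card = α.count x - 1 := by
  rw [count_eq_card]
  set F := {r ∈ Finset.Icc 1 α.length | varAt α r = x} with hF
  have hne : F.Nonempty := by
    obtain ⟨i, h1, h2, h3⟩ := exists_varAt_of_mem hx
    exact ⟨i, by simp [hF, h1, h2, h3]⟩
  have hmin := F.min'_mem hne
  rw [← Finset.card_erase_of_mem hmin]
  congr 1
  ext r
  simp only [Finset.mem_filter, Finset.mem_Icc, Finset.mem_erase, hF]
  constructor
  · rintro ⟨h1, h2, h3⟩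
    refine ⟨fun e => ?_, h1, h3⟩
    have hlt := prevOcc_lt (α := α) h1.1
    have hmem : prevOcc α r ∈ F := by
      simp only [hF, Finset.mem_filter, Finset.mem_Icc]
      exact ⟨⟨by omega, by omega⟩, by rw [varAt_prevOcc h2, h3]⟩
    have := F.min'_le _ hmem
    simp only [← hF] at e
    omega
  · rintro ⟨h1, h2, h3⟩
    refine ⟨h2, ?_, h3⟩
    have hle := F.min'_le r (by simp [hF, h2, h3])
    simp only [hF, Finset.mem_filter, Finset.mem_Icc] at hmin h1 hle
    have := le_prevOcc (α := α) (r := r) hmin.1.1 (by omega) (by rw [hmin.2, h3])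
    omega

theorem isMatchingOrder_canonical {α : List ℕ} {x : ℕ} (hx : x ∈ α) :
    IsMatchingOrder α x ((canonicalMatching α).filter fun m => varAt α m.2 = x) := by
  refine ⟨?_, ?_, ?_⟩
  · rw [← card_prevOcc_ne_zero hx, canonicalMatching, List.filter_map, List.length_map,
      List.filter_filter,
      ← List.toFinset_card_of_nodup ((List.nodup_range' (s := 1) (n := α.length)).filter _)]
    congr 1
    ext r
    simp only [Finset.mem_filter, Finset.mem_Icc, List.mem_toFinset, List.mem_filter,
      List.mem_range'_1, Function.comp, Bool.and_eq_true, decide_eq_true_eq]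
    omega
  · intro m hm
    rw [List.mem_filter, decide_eq_true_eq] at hm
    have hv := varAt_eq_of_mem_canonicalMatching hm.1
    obtain ⟨h1, -, h3, h4⟩ := mem_canonicalMatching.1 hm.1
    exact ⟨⟨by omega, by omega, by rw [hv, hm.2]⟩, ⟨by omega, by omega, hm.2⟩, h4⟩
  · set G := SimpleGraph.fromRel fun a b : varpos α x =>
      (a.1, b.1) ∈ (canonicalMatching α).filter fun m => varAt α m.2 = x with hG
    have hfirst : ∀ q : varpos α x, ∃ q₀ : varpos α x, prevOcc α q₀ = 0 ∧ G.Reachable q q₀ := by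
      rintro ⟨q, hq⟩
      induction q using Nat.strong_induction_on with
      | _ q ih =>
        by_cases h0 : prevOcc α q = 0
        · exact ⟨⟨q, hq⟩, h0, SimpleGraph.Reachable.refl _⟩
        have hlt := prevOcc_lt (α := α) hq.1
        have hp : prevOcc α q ∈ varpos α x :=
          ⟨by omega, hlt.le.trans hq.2.1, by rw [varAt_prevOcc h0, hq.2.2]⟩
        obtain ⟨q₀, h1, h2⟩ := ih _ hlt hp
        refine ⟨q₀, h1, SimpleGraph.Reachable.trans (SimpleGraph.Adj.reachable ?_) h2⟩
        rw [hG, SimpleGraph.fromRel_adj]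
        refine ⟨fun e => ?_, Or.inr ?_⟩
        · rw [Subtype.mk.injEq] at e; omega
        · rw [List.mem_filter, decide_eq_true_eq]
          exact ⟨mem_canonicalMatching.2 ⟨hq.2.1, rfl, hp.1, hlt⟩, hq.2.2⟩
    have huniq : ∀ q q' : varpos α x, prevOcc α q = 0 → prevOcc α q' = 0 → q = q' := by
      rintro ⟨q, hq⟩ ⟨q', hq'⟩ h h'
      simp only at h h'
      rw [Subtype.mk.injEq]
      rcases lt_trichotomy q q' with hlt | rfl | hlt
      · have := le_prevOcc hq.1 hlt (hq.2.2.trans hq'.2.2.symm)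
        have := hq.1
        omega
      · rfl
      · have := le_prevOcc hq'.1 hlt (hq'.2.2.trans hq.2.2.symm)
        have := hq'.1
        omega
    rw [SimpleGraph.connected_iff]
    constructor
    · intro q q'
      obtain ⟨q₀, h1, h2⟩ := hfirst q
      obtain ⟨q₁, h3, h4⟩ := hfirst q'
      rw [huniq _ _ h3 h1] at h4
      exact h2.trans h4.symm
    · obtain ⟨i, h1, h2, h3⟩ := exists_varAt_of_mem hx
      exact ⟨i, h1, h2, h3⟩

theorem isCompleteMatchingOrder_canonical (α : List ℕ) :
    IsCompleteMatchingOrder α (canonicalMatching α) := by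
  refine ⟨?_, fun x => (canonicalMatching α).filter fun m => varAt α m.2 = x, fun x hx =>
    ⟨isMatchingOrder_canonical hx, fun m hm => (List.mem_filter.1 hm).1⟩⟩
  rw [canonicalMatching, List.length_map,
    ← List.toFinset_card_of_nodup ((List.nodup_range' (s := 1) (n := α.length)).filter _),
    Finset.card_eq_sum_card_fiberwise (f := varAt α) (t := α.toFinset)]
  · refine Finset.sum_congr rfl fun x hx => ?_
    rw [← card_prevOcc_ne_zero (List.mem_toFinset.1 hx)]
    congr 1
    ext r
    simp only [Finset.mem_filter, Finset.mem_Icc, List.mem_toFinset, List.mem_filter,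
      List.mem_range'_1, decide_eq_true_eq]
    rw [and_assoc]
    exact and_congr_left fun _ => by omega
  · intro r hr
    simp only [Finset.mem_coe, List.mem_toFinset, List.mem_filter, List.mem_range'_1] at hr
    simpa using varAt_mem (β := α) hr.1.1 (by omega)

/-! ### The canonical operating mode -/

theorem mem_passed_of_lt {j j' q : ℕ} (h : j < j') : q ∈ passed j j' ↔ j < q ∧ q < j' := by
  rw [passed, if_pos h, List.mem_range'_1]
  omega

theorem mem_passed_of_le {j j' q : ℕ} (h : j' ≤ j) : q ∈ passed j j' ↔ j' ≤ q ∧ q ≤ j := by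
  rw [passed, if_neg (by omega), List.mem_reverse, List.mem_range'_1]
  omega

/-- The first moves of the left head from `m` to `m'`: it goes towards its goal, but does not
leave the factors that the right head has passed before. -/
def earlyMoves (m m' : ℕ × ℕ) : List ℕ := passed m.1 (min m'.1 (m.2 + 1))

/-- The remaining moves of the left head, carried out after those of the right head. -/
def lateMoves (m m' : ℕ × ℕ) : List ℕ := List.range' (m.2 + 1) (m'.1 - 1 - m.2)

/-- The canonical interleaving: the left head moves as far as possible before the right head
starts to move. -/
def canonicalBlock (m m' : ℕ × ℕ) : List (ℕ × Head) :=
  (earlyMoves m m').map (·, .left) ++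
    ((passed m.2 m'.2).map (·, .right) ++ (lateMoves m m').map (·, .left))

/-- The Janus operating mode that consists of the canonical interleavings. -/
def canonicalMode (α : List ℕ) : List (List (ℕ × Head)) :=
  (List.range (canonicalMatching α).length).map fun i =>
    canonicalBlock (previousPos (canonicalMatching α) i) (matchingPos (canonicalMatching α) i) ++
      [((matchingPos (canonicalMatching α) i).2, .right),
        ((matchingPos (canonicalMatching α) i).1, .left)]

theorem track_map_self (μ : Head) (L : List ℕ) : track μ (L.map (·, μ)) = L := by
  simp [track, List.filter_map, Function.comp_def]

theorem track_map_of_ne {μ μ' : Head} (h : μ' ≠ μ) (L : List ℕ) : track μ (L.map (·, μ')) = [] := by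
  simp [track, List.filter_map, Function.comp_def, h]

theorem le_of_mem_earlyMoves {m m' : ℕ × ℕ} (hm : m.1 ≤ m.2) {q : ℕ} (h : q ∈ earlyMoves m m') :
    q ≤ m.2 := by
  unfold earlyMoves at h
  rcases lt_or_ge m.1 (min m'.1 (m.2 + 1)) with hlt | hlt
  · rw [mem_passed_of_lt hlt] at h; omega
  · rw [mem_passed_of_le hlt] at h; omega

theorem earlyMoves_append_lateMoves {m m' : ℕ × ℕ} (hm : m.1 ≤ m.2) :
    earlyMoves m m' ++ lateMoves m m' = passed m.1 m'.1 := by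
  unfold earlyMoves lateMoves
  rcases Nat.lt_or_ge (m.2 + 1) m'.1 with h | h
  · rw [min_eq_right h.le, passed, if_pos (by omega), passed, if_pos (by omega)]
    have e := List.range'_append (s := m.1 + 1) (m := m.2 + 1 - m.1 - 1)
      (n := m'.1 - 1 - m.2) (step := 1)
    rw [show m.1 + 1 + 1 * (m.2 + 1 - m.1 - 1) = m.2 + 1 by omega] at e
    rw [e]
    congr 1
    omega
  · rw [min_eq_left h, show m'.1 - 1 - m.2 = 0 by omega]
    simp

theorem isInterleaving_canonicalBlock {m m' : ℕ × ℕ} (hm : m.1 ≤ m.2) (hm' : m'.1 < m'.2)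
    (hr : m.2 < m'.2) : IsInterleaving m m' (canonicalBlock m m') := by
  have hl : track .left (canonicalBlock m m') = passed m.1 m'.1 := by
    rw [canonicalBlock, track_append, track_append, track_map_self, track_map_self,
      track_map_of_ne (by decide), List.nil_append, earlyMoves_append_lateMoves hm]
  have hrt : track .right (canonicalBlock m m') = passed m.2 m'.2 := by
    rw [canonicalBlock, track_append, track_append, track_map_self,
      track_map_of_ne (by decide), track_map_of_ne (by decide), List.nil_append, List.append_nil]
  refine ⟨hl, hrt, ?_⟩
  intro j hj1 hj a ha b hb
  have hbmem : b ∈ passed m.2 m'.2 := by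
    simp only [headEntry, hrt, Option.mem_def, Option.or_eq_some_iff] at hb
    rcases hb with hb | ⟨-, hb⟩
    · have h1 := List.mem_of_getLast? hb
      rw [mem_track] at h1
      rw [← hrt, mem_track]
      exact List.mem_of_mem_take h1
    · exact List.mem_of_head? hb
  rw [mem_passed_of_lt hr] at hbmem
  have hlate : ∀ q ∈ lateMoves m m', q < m'.1 ∧ m.2 < q := by
    intro q hq
    rw [lateMoves, List.mem_range'_1] at hq
    omega
  set A := earlyMoves m m' with hA
  set R := passed m.2 m'.2 with hR
  set B := lateMoves m m' with hB
  have hamem : a ∈ A ∨ a ∈ B := by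
    rw [← List.mem_append, hA, hB, earlyMoves_append_lateMoves hm, ← hl]
    simp only [headEntry, Option.mem_def, Option.or_eq_some_iff] at ha
    rcases ha with ha | ⟨-, ha⟩
    · have h1 := List.mem_of_getLast? ha
      rw [mem_track] at h1 ⊢
      exact List.mem_of_mem_take h1
    · exact List.mem_of_head? ha
  rcases hamem with haA | haB
  · have := le_of_mem_earlyMoves hm haA
    omega
  have haB' := hlate a haB
  rcases Nat.lt_or_ge (A.length + R.length) j with hjj | hjj
  · -- The right head has finished its moves.
    have e : (canonicalBlock m m').take j =
        A.map (·, Head.left) ++ (R.map (·, Head.right) ++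
          (B.map (·, Head.left)).take (j - A.length - R.length)) := by
      rw [canonicalBlock, ← hA, ← hR, ← hB, List.take_append, List.take_append,
        List.length_map, List.length_map,
        List.take_of_length_le (by rw [List.length_map]; omega),
        List.take_of_length_le (by rw [List.length_map]; omega)]
    have hb' : R.getLast? = some b := by
      simp only [headEntry, hrt] at hb
      rw [e, track_append, track_append, track_map_self, track_map_of_ne (by decide),
        ← List.map_take, track_map_of_ne (by decide), List.nil_append, List.append_nil] at hb
      cases hg : R.getLast? with
      | none => rw [List.getLast?_eq_none_iff] at hg; simp [hg] at hb
      | some c => simpa [hg] using hb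
    rw [hR, passed, if_pos hr, List.getLast?_range'] at hb'
    split_ifs at hb'
    simp only [Option.some.injEq] at hb'
    omega
  · -- The left head has not started its late moves.
    have e : (track .left ((canonicalBlock m m').take j)) <+: A := by
      have h1 : (canonicalBlock m m').take j <+:
          A.map (·, Head.left) ++ R.map (·, Head.right) := by
        have : (canonicalBlock m m').take j =
            (A.map (·, Head.left) ++ R.map (·, Head.right)).take j := by
          rw [canonicalBlock, ← List.append_assoc, List.take_append_of_le_length]
          simpa using hjj
        rw [this]
        exact List.take_prefix _ _
      have h2 : track .left (A.map (·, Head.left) ++ R.map (·, Head.right)) = A := by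
        rw [track_append, track_map_self, track_map_of_ne (by decide), List.append_nil]
      rw [← h2]
      exact (h1.filter _).map _
    simp only [headEntry, hl, Option.mem_def, Option.or_eq_some_iff] at ha
    rcases ha with ha | ⟨-, ha⟩
    · have := le_of_mem_earlyMoves hm (e.subset (List.mem_of_getLast? ha))
      omega
    · rw [← earlyMoves_append_lateMoves hm, ← hA, ← hB] at ha
      cases hA' : A with
      | cons c A' =>
        have : c = a := by simpa [hA'] using ha
        have := le_of_mem_earlyMoves hm (q := c) (by rw [← hA, hA']; simp)
        omega
      | nil =>
        rw [hA', List.nil_append, hB, lateMoves, List.head?_range'] at ha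
        split_ifs at ha
        simp only [Option.some.injEq] at ha
        omega

theorem isOperatingMode_canonical (α : List ℕ) :
    IsOperatingMode α (canonicalMatching α) (canonicalMode α) := by
  refine ⟨isCompleteMatchingOrder_canonical α, by simp [canonicalMode], fun i hi => ?_⟩
  obtain ⟨h1, h2⟩ := previousPos_canonicalMatching hi
  obtain ⟨-, -, -, h3⟩ := mem_canonicalMatching.1 (matchingPos_mem hi)
  refine ⟨_, isInterleaving_canonicalBlock h1 h3 h2, ?_⟩
  simp [canonicalMode, hi]

/-! ### The counter number of the canonical operating mode -/

/-- Locating an entry of a concatenation of blocks: it lies in some block `f j`, everything before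
it comes from this block or earlier ones, and everything after it from this block or later
ones. -/
theorem exists_of_flatMap_range_eq {β : Type*} {f : ℕ → List β} {k : ℕ} {E₁ E₂ : List β} {e : β}
    (h : (List.range k).flatMap f = E₁ ++ e :: E₂) :
    ∃ j < k, ∃ F₁ F₂, f j = F₁ ++ e :: F₂ ∧ (∀ v ∈ E₁, v ∈ F₁ ∨ ∃ i < j, v ∈ f i) ∧
      ∀ v ∈ E₂, v ∈ F₂ ∨ ∃ i, j < i ∧ i < k ∧ v ∈ f i := by
  induction k generalizing E₂ with
  | zero => simp at h
  | succ k ih =>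
    rw [List.range_succ, List.flatMap_append, List.flatMap_singleton] at h
    have hsub : ∀ v ∈ (List.range k).flatMap f, ∃ i < k, v ∈ f i := by simp
    rcases List.append_eq_append_iff.1 h with ⟨F₁, h1, h2⟩ | ⟨c, h1, h2⟩
    · refine ⟨k, by omega, F₁, E₂, h2, fun v hv => ?_, fun v hv => Or.inl hv⟩
      rw [h1, List.mem_append] at hv
      exact hv.elim (fun hv => Or.inr (hsub v hv)) Or.inl
    · rcases List.cons_eq_append_iff.1 h2 with ⟨rfl, h3⟩ | ⟨c', rfl, rfl⟩
      · rw [List.append_nil] at h1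
        refine ⟨k, by omega, [], E₂, h3, fun v hv => Or.inr (hsub v (h1 ▸ hv)),
          fun v hv => Or.inl hv⟩
      · obtain ⟨j, hj, F₁, F₂, h3, h4, h5⟩ := ih h1
        refine ⟨j, by omega, F₁, F₂, h3, h4, fun v hv => ?_⟩
        rcases List.mem_append.1 hv with hv | hv
        · rcases h5 v hv with h6 | ⟨i, h6, h7, h8⟩
          · exact Or.inl h6
          · exact Or.inr ⟨i, h6, by omega, h8⟩
        · exact Or.inr ⟨k, hj, by omega, hv⟩

theorem mem_canonicalBlock {m m' : ℕ × ℕ} (hm : m.1 ≤ m.2) (hl : 1 ≤ m'.1) (hm' : m'.1 < m'.2)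
    (hr : m.2 < m'.2) {v : ℕ × Head}
    (hv : v ∈ canonicalBlock m m' ++ [(m'.2, .right), (m'.1, .left)]) :
    1 ≤ v.1 ∧ v.1 ≤ m'.2 ∧ (m.1 ≤ v.1 ∨ m'.1 ≤ v.1) := by
  simp only [canonicalBlock, List.mem_append, List.mem_map, List.mem_cons, List.not_mem_nil,
    or_false] at hv
  rcases hv with (⟨q, hq, rfl⟩ | ⟨q, hq, rfl⟩ | ⟨q, hq, rfl⟩) | rfl | rfl
  · simp only
    rw [earlyMoves] at hq
    rcases lt_or_ge m.1 (min m'.1 (m.2 + 1)) with hlt | hlt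
    · rw [mem_passed_of_lt hlt] at hq; omega
    · rw [mem_passed_of_le hlt] at hq; omega
  · rw [mem_passed_of_lt hr] at hq; simp only; omega
  · rw [lateMoves, List.mem_range'_1] at hq; simp only; omega
  · simp only; omega
  · simp only; omega

/-- At every moment of the canonical operating mode there is a pair `m` of consecutive occurrences
of some variable such that everything visited so far lies at or before `m.2`, and everything
visited from now on lies at or after `m.1`. -/
theorem exists_window {α : List ℕ} (hα : ∀ x ∈ α, 2 ≤ α.count x) {E₁ E₂ : List (ℕ × Head)}
    {e : ℕ × Head} (h : (canonicalMode α).flatten = E₁ ++ e :: E₂) :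
    ∃ m ∈ canonicalMatching α, (∀ v ∈ E₁, v.1 ≤ m.2) ∧ e.1 ≤ m.2 ∧ m.1 ≤ e.1 ∧
      ∀ v ∈ E₂, m.1 ≤ v.1 := by
  set ms := canonicalMatching α with hms
  rw [canonicalMode, ← List.flatMap_def, ← hms] at h
  obtain ⟨j, hj, F₁, F₂, hF, h1, h2⟩ := exists_of_flatMap_range_eq h
  have hcur : ∀ i < ms.length, matchingPos ms i ∈ ms := fun i hi => matchingPos_mem hi
  have hb : ∀ i < ms.length, ∀ v ∈ canonicalBlock (previousPos ms i) (matchingPos ms i) ++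
      [((matchingPos ms i).2, .right), ((matchingPos ms i).1, .left)],
      1 ≤ v.1 ∧ v.1 ≤ (matchingPos ms i).2 ∧
        ((previousPos ms i).1 ≤ v.1 ∨ (matchingPos ms i).1 ≤ v.1) := by
    intro i hi v hv
    obtain ⟨h3, h4⟩ := previousPos_canonicalMatching hi
    obtain ⟨-, -, h5, h6⟩ := mem_canonicalMatching.1 (hcur i hi)
    exact mem_canonicalBlock h3 h5 h6 h4 hv
  -- The matching position `i₀` with the leftmost left component among those still to come.
  obtain ⟨i₀, hi₀, hmin⟩ := (Finset.Ico j ms.length).exists_min_image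
    (fun i => (matchingPos ms i).1) ⟨j, by simp [hj]⟩
  rw [Finset.mem_Ico] at hi₀
  have hlow : ∀ i, j ≤ i → i < ms.length → (matchingPos ms i₀).1 ≤ (matchingPos ms i).1 :=
    fun i hi hi' => hmin i (by simp [hi, hi'])
  have hafter : ∀ v, (∃ i, j < i ∧ i < ms.length ∧ v ∈ canonicalBlock (previousPos ms i)
      (matchingPos ms i) ++ [((matchingPos ms i).2, Head.right), ((matchingPos ms i).1, .left)]) →
      (matchingPos ms i₀).1 ≤ v.1 := by
    rintro v ⟨i, hi, hi', hv⟩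
    obtain ⟨i, rfl⟩ : ∃ i', i = i' + 1 := ⟨i - 1, by omega⟩
    have h3 := hlow i (by omega) (by omega)
    have h4 := hlow (i + 1) (by omega) hi'
    have h5 := (hb (i + 1) hi' v hv).2.2
    rw [previousPos_succ] at h5
    omega
  have hbefore : ∀ v ∈ E₁ ++ [e], v.1 ≤ (matchingPos ms j).2 := by
    intro v hv
    have : v ∈ F₁ ++ e :: F₂ ∨ ∃ i < j, v ∈ canonicalBlock (previousPos ms i)
        (matchingPos ms i) ++
        [((matchingPos ms i).2, Head.right), ((matchingPos ms i).1, .left)] := by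
      rcases List.mem_append.1 hv with hv | hv
      · exact (h1 v hv).imp (fun h => by simp [h]) id
      · simp only [List.mem_singleton] at hv; simp [hv]
    rcases this with hv | ⟨i, hi, hv⟩
    · rw [← hF] at hv; exact (hb j hj v hv).2.1
    · exact (hb i (by omega) v hv).2.1.trans (canonicalMatching_mono hi.le hj)
  have hi₀j : (matchingPos ms j).2 ≤ (matchingPos ms i₀).2 := canonicalMatching_mono hi₀.1 hi₀.2
  -- The window `i₀` works as soon as the rest of the current block stays right of it.
  have hmain : (∀ v ∈ e :: F₂, (matchingPos ms i₀).1 ≤ v.1) → ∃ m ∈ ms, (∀ v ∈ E₁, v.1 ≤ m.2) ∧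
      e.1 ≤ m.2 ∧ m.1 ≤ e.1 ∧ ∀ v ∈ E₂, m.1 ≤ v.1 := fun hrest =>
    ⟨_, hcur i₀ hi₀.2, fun v hv => (hbefore v (by simp [hv])).trans hi₀j,
      (hbefore e (by simp)).trans hi₀j, hrest e (by simp), fun v hv =>
      (h2 v hv).elim (fun hv => hrest v (by simp [hv])) (hafter v)⟩
  obtain ⟨hp1, hp2⟩ := previousPos_canonicalMatching hj
  obtain ⟨-, -, hc1, hc2⟩ := mem_canonicalMatching.1 (hcur j hj)
  rw [← hms] at hp1 hp2
  have hlowj := hlow j le_rfl hj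
  rw [canonicalBlock, List.append_assoc] at hF
  have hcase : (∃ c, e :: F₂ = c ++ ((passed (previousPos ms j).2 (matchingPos ms j).2).map
      (·, Head.right) ++ (lateMoves (previousPos ms j) (matchingPos ms j)).map (·, Head.left) ++
      [((matchingPos ms j).2, .right), ((matchingPos ms j).1, .left)]) ∧
      e ∈ c ∧ (earlyMoves (previousPos ms j) (matchingPos ms j)).map (·, Head.left) = F₁ ++ c) ∨
      ∃ F, (passed (previousPos ms j).2 (matchingPos ms j).2).map
      (·, Head.right) ++ (lateMoves (previousPos ms j) (matchingPos ms j)).map (·, Head.left) ++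
      [((matchingPos ms j).2, .right), ((matchingPos ms j).1, .left)] = F ++ e :: F₂ := by
    rcases List.append_eq_append_iff.1 hF with ⟨F, -, h3⟩ | ⟨c, h3, h4⟩
    · exact Or.inr ⟨F, h3⟩
    · rcases List.cons_eq_append_iff.1 h4 with ⟨rfl, h5⟩ | ⟨c', rfl, -⟩
      · exact Or.inr ⟨[], h5⟩
      · exact Or.inl ⟨e :: c', h4, by simp, h3⟩
  have hrest : ∀ v ∈ (passed (previousPos ms j).2 (matchingPos ms j).2).map
      (·, Head.right) ++ (lateMoves (previousPos ms j) (matchingPos ms j)).map (·, Head.left) ++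
      [((matchingPos ms j).2, Head.right), ((matchingPos ms j).1, .left)],
      (matchingPos ms i₀).1 ≤ v.1 := by
    have hpass : ∀ q, (previousPos ms j).2 < q → q < (matchingPos ms j).2 →
        (matchingPos ms i₀).1 ≤ q := by
      intro q hq hq'
      -- The first factor that the right head passes is a first occurrence.
      set r := (previousPos ms j).2 + 1 with hr
      have hrl : r < α.length :=
        lt_of_lt_of_le (by omega) (mem_canonicalMatching.1 (hcur j hj)).1
      obtain ⟨q', hq1, hq2⟩ : ∃ q' ∈ varpos α (varAt α r), q' ≠ r := by
        have := hα (varAt α r) (varAt_mem (by omega) hrl.le)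
        rw [count_eq_card] at this
        obtain ⟨q', h3, h4⟩ := Finset.exists_mem_ne this r
        simp only [Finset.mem_filter, Finset.mem_Icc] at h3
        exact ⟨q', ⟨h3.1.1, h3.1.2, h3.2⟩, h4⟩
      have hjump : ∀ m ∈ ms, m.2 < (matchingPos ms j).2 → m.2 < r := by
        intro m hm hlt
        obtain ⟨i, hi, rfl⟩ := exists_matchingPos_eq hm
        have hij : i < j := by
          by_contra hcon
          have := canonicalMatching_mono (not_lt.1 hcon) hi
          rw [← hms] at this
          omega
        obtain ⟨j', rfl⟩ : ∃ j', j = j' + 1 := ⟨j - 1, by omega⟩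
        have := canonicalMatching_mono (α := α) (i := i) (j := j') (by omega) (by rw [← hms]; omega)
        rw [← hms] at this
        rw [previousPos_succ] at hr
        omega
      have hfirst : prevOcc α r = 0 := by
        by_contra hcon
        have h3 := prevOcc_lt (α := α) (r := r) (by omega)
        have := hjump (prevOcc α r, r)
          (mem_canonicalMatching.2 ⟨hrl.le, rfl, by simp only; omega, h3⟩)
          (by simp only; omega)
        simp at this
      have hq'r : r < q' := by
        by_contra hcon
        have := le_prevOcc hq1.1 (by omega) hq1.2.2
        have := hq1.1
        omega
      -- The next occurrence of its variable after `r` is matched with `r`.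
      have hex : ∃ d, r < d ∧ varAt α d = varAt α r := ⟨q', hq'r, hq1.2.2⟩
      obtain ⟨hd1, hd2⟩ := Nat.find_spec hex
      have hdle := Nat.find_min' hex ⟨hq'r, hq1.2.2⟩
      set d := Nat.find hex with hd
      have h3 := le_prevOcc (α := α) (r := d) (q := r) (by omega) hd1 hd2.symm
      have h4 := prevOcc_lt (α := α) (r := d) (by omega)
      have h5 := varAt_prevOcc (α := α) (r := d) (by omega)
      have h6 : prevOcc α d = r := by
        by_contra hcon
        exact Nat.find_min hex h4 ⟨by omega, by rw [h5, hd2]⟩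
      have hmem : (r, d) ∈ ms := mem_canonicalMatching.2
        ⟨hdle.trans hq1.2.1, h6.symm, by simp only; omega, hd1⟩
      obtain ⟨i, hi, hid⟩ := exists_matchingPos_eq hmem
      have hji : j ≤ i := by
        by_contra hcon
        have h7 := canonicalMatching_strictMono (α := α) (not_le.1 hcon) hj
        rw [← hms, hid] at h7
        have := hjump _ hmem h7
        simp only at this
        omega
      have := hlow i hji hi
      rw [hid] at this
      simp only at this
      omega
    intro v hv
    simp only [List.mem_append, List.mem_map, List.mem_cons, List.not_mem_nil, or_false] at hv
    rcases hv with (⟨q, hq, rfl⟩ | ⟨q, hq, rfl⟩) | rfl | rfl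
    · rw [mem_passed_of_lt hp2] at hq
      exact hpass q hq.1 hq.2
    · rw [lateMoves, List.mem_range'_1] at hq
      exact hpass q (by omega) (by omega)
    · simp only; omega
    · simp only; omega
  rcases hcase with ⟨c, hc, hec, hearly⟩ | ⟨F, hF'⟩
  · have hcmem : ∀ v ∈ c, v.1 ∈ earlyMoves (previousPos ms j) (matchingPos ms j) := by
      intro v hv
      have : v ∈ (earlyMoves (previousPos ms j) (matchingPos ms j)).map (·, Head.left) := by
        rw [hearly]; simp [hv]
      obtain ⟨q, hq, rfl⟩ := List.mem_map.1 this
      exact hq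
    have hcge : ∀ v ∈ c, (previousPos ms j).1 ≤ v.1 ∨ (matchingPos ms j).1 ≤ v.1 := by
      intro v hv
      have h3 := hcmem v hv
      rw [earlyMoves] at h3
      rcases lt_or_ge (previousPos ms j).1
        (min (matchingPos ms j).1 ((previousPos ms j).2 + 1)) with hlt | hlt
      · rw [mem_passed_of_lt hlt] at h3; omega
      · rw [mem_passed_of_le hlt] at h3; omega
    rcases le_or_gt (matchingPos ms i₀).1 (previousPos ms j).1 with hle | hgt
    · refine hmain fun v hv => ?_
      rw [hc] at hv
      rcases List.mem_append.1 hv with hv | hv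
      · have := hcge v hv; omega
      · exact hrest v hv
    · -- The left head still has to pass factors in the window of the previous matching.
      cases j with
      | zero =>
        have h3 := hcmem e hec
        rw [previousPos_zero] at h3
        have h4 := le_of_mem_earlyMoves (m := (0, 0)) le_rfl h3
        rw [hc] at hF
        have h5 : e ∈ canonicalBlock (previousPos ms 0) (matchingPos ms 0) ++
            [((matchingPos ms 0).2, Head.right), ((matchingPos ms 0).1, .left)] := by
          rw [canonicalBlock, List.append_assoc, hF]
          simp [hec]
        have := (hb 0 hj e h5).1
        simp only at h4
        omega
      | succ j =>
        rw [previousPos_succ] at hgt hcge hcmem hp1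
        have hprev : ∀ v ∈ F₁ ++ c, v.1 ≤ (matchingPos ms j).2 := by
          intro v hv
          rw [← hearly] at hv
          obtain ⟨q, hq, rfl⟩ := List.mem_map.1 hv
          exact le_of_mem_earlyMoves hp1 hq
        have hge : ∀ v ∈ e :: F₂, (matchingPos ms j).1 ≤ v.1 := by
          intro v hv
          rw [hc] at hv
          rcases List.mem_append.1 hv with hv | hv
          · have := hcge v hv; omega
          · have := hrest v hv; omega
        refine ⟨_, hcur j (by omega), fun v hv => ?_, hprev e (by simp [hec]), hge e (by simp),
          fun v hv => ?_⟩
        · rcases h1 v hv with hv | ⟨i, hi, hv⟩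
          · exact hprev v (by simp [hv])
          · exact (hb i (by omega) v hv).2.1.trans
              (canonicalMatching_mono (by omega) (by rw [← hms]; omega))
        · rcases h2 v hv with hv | hv
          · exact hge v (by simp [hv])
          · have := hafter v hv; omega
  · exact hmain fun v hv => hrest v (by rw [hF']; simp only [List.mem_append]; exact Or.inr hv)

/-- A window contains the variables of a gap and the variable at its two ends. -/
theorem card_image_varAt_le {α : List ℕ} {m : ℕ × ℕ} (hm : m ∈ canonicalMatching α) :
    ((Finset.Icc m.1 m.2).image (varAt α)).card ≤ variableDistance α + 1 := by
  obtain ⟨l, r⟩ := m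
  have hv := varAt_eq_of_mem_canonicalMatching hm
  obtain ⟨h1, h2, h3, h4⟩ := mem_canonicalMatching.1 hm
  simp only at h1 h2 h3 h4 hv ⊢
  have hl : varAt α l = α[l - 1] := by simp [varAt, show l - 1 < α.length by omega]
  have hr : varAt α r = α[r - 1] := by simp [varAt, show r - 1 < α.length by omega]
  set γ := (α.drop l).take (r - 1 - l) with hγ
  have hmem : ∀ q, l < q → q < r → varAt α q ∈ γ := by
    intro q hq hq'
    refine List.mem_of_getElem? (i := q - 1 - l) ?_
    rw [hγ, List.getElem?_take_of_lt (by omega), List.getElem?_drop,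
      show l + (q - 1 - l) = q - 1 by omega, List.getElem?_eq_getElem (by omega)]
    simp [varAt, show q - 1 < α.length by omega]
  have hnot : varAt α l ∉ γ := by
    intro hx
    obtain ⟨i, hi⟩ := List.mem_iff_getElem?.1 hx
    have hil := (List.getElem?_eq_some_iff.1 hi).1
    rw [hγ, List.length_take, List.length_drop] at hil
    rw [hγ, List.getElem?_take_of_lt (by omega), List.getElem?_drop] at hi
    have : varAt α (l + i + 1) = varAt α r := by
      rw [← hv]
      simp [varAt, hi]
    have := le_prevOcc (α := α) (q := l + i + 1) (by omega) (by omega) this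
    omega
  have hα : α = α.take (l - 1) ++ [varAt α l] ++ γ ++ [varAt α l] ++ α.drop r := by
    have e1 := List.take_append_drop (l - 1) α
    have e2 : α.drop (l - 1) = α[l - 1] :: α.drop l := by
      rw [List.drop_eq_getElem_cons (by omega), show l - 1 + 1 = l by omega]
    have e3 := List.take_append_drop (r - 1 - l) (α.drop l)
    rw [List.drop_drop, show l + (r - 1 - l) = r - 1 by omega,
      List.drop_eq_getElem_cons (i := r - 1) (by omega), show r - 1 + 1 = r by omega] at e3
    conv_lhs => rw [← e1, e2, ← e3, ← hl, ← hr, ← hv]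
    simp [hγ]
  have hd := variableDistance_spec α _ (varAt_mem h3 (by omega)) _ _ _ hα hnot
  refine (Finset.card_le_card (t := insert (varAt α l) γ.toFinset) ?_).trans
    ((Finset.card_insert_le _ _).trans (by omega))
  intro x hx
  obtain ⟨q, hq, rfl⟩ := Finset.mem_image.1 hx
  rw [Finset.mem_Icc] at hq
  rw [Finset.mem_insert, List.mem_toFinset]
  rcases hq.1.eq_or_lt with rfl | hlt
  · exact Or.inl rfl
  rcases hq.2.eq_or_lt with rfl | hlt'
  · exact Or.inl hv.symm
  · exact Or.inr (hmem q hlt hlt')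

theorem mem_canonicalMode_bounds {α : List ℕ} {v : ℕ × Head}
    (hv : v ∈ (canonicalMode α).flatten) : 1 ≤ v.1 ∧ v.1 ≤ α.length := by
  rw [canonicalMode, ← List.flatMap_def, List.mem_flatMap] at hv
  obtain ⟨i, hi, hv⟩ := hv
  rw [List.mem_range] at hi
  obtain ⟨h3, h4⟩ := previousPos_canonicalMatching hi
  obtain ⟨h7, -, h5, h6⟩ := mem_canonicalMatching.1 (matchingPos_mem hi)
  obtain ⟨h8, h9, -⟩ := mem_canonicalBlock h3 h5 h6 h4 hv
  exact ⟨h8, h9.trans h7⟩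

theorem counterNumber_canonical_le {α : List ℕ} (hα : ∀ x ∈ α, 2 ≤ α.count x) :
    counterNumber α (canonicalMode α) ≤ variableDistance α := by
  rw [counterNumber_eq]
  refine Finset.sup_le fun t ht => ?_
  rw [Finset.mem_range] at ht
  have htl : t < (canonicalMode α).flatten.length := by
    rwa [movementWord, List.length_map] at ht
  have hbd : ∀ v ∈ (canonicalMode α).flatten, 1 ≤ v.1 ∧ v.1 ≤ α.length :=
    fun v hv => mem_canonicalMode_bounds hv
  have hW : ∀ i, (movementWord α (canonicalMode α))[i]? =
      (canonicalMode α).flatten[i]?.map fun e : ℕ × Head => varAt α e.1 := fun i => by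
    rw [movementWord, List.getElem?_map]
  have hvisit := fun m hm =>
    (isOperatingMode_canonical α).exists_visit_of_mem (m := m) hm
  have hsplit := List.take_append_drop t (canonicalMode α).flatten
  rw [List.drop_eq_getElem_cons htl] at hsplit
  obtain ⟨m, hm, h1, h2, h3, h4⟩ := exists_window hα hsplit.symm
  generalize (canonicalMode α).flatten = E at *
  set W := movementWord α (canonicalMode α)
  have hbefore : ∀ i v, i ≤ t → E[i]? = some v → v.1 ≤ m.2 := by
    intro i v hi hv
    rcases hi.eq_or_lt with rfl | hi
    · rw [List.getElem?_eq_getElem htl, Option.some.injEq] at hv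
      rwa [← hv]
    · exact h1 v (List.mem_of_getElem? (i := i) (by rwa [List.getElem?_take_of_lt hi]))
  have hafter : ∀ i v, t < i → E[i]? = some v → m.1 ≤ v.1 := by
    intro i v hi hv
    exact h4 v (List.mem_of_getElem? (i := i - (t + 1))
      (by rwa [List.getElem?_drop, show t + 1 + (i - (t + 1)) = i by omega]))
  have hz : W[t]? = some (varAt α E[t].1) := by
    rw [hW, List.getElem?_eq_getElem htl]; rfl
  have hsub : insert (varAt α E[t].1) (activeAt W t) ⊆
      ((Finset.Icc m.1 m.2).image (varAt α) : Finset ℕ) := by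
    refine Set.insert_subset ?_ ?_
    · exact Finset.mem_coe.2 (Finset.mem_image_of_mem _ (Finset.mem_Icc.2 ⟨h3, h2⟩))
    rintro x ⟨i, j, hi, hj, hxi, hxj, -⟩
    rw [hW, Option.map_eq_some_iff] at hxi hxj
    obtain ⟨a, ha, hax⟩ := hxi
    obtain ⟨b, hb, hbx⟩ := hxj
    have ha1 := hbefore i a hi.le ha
    have hb1 := hafter j b hj hb
    have ha2 := (hbd a (List.mem_of_getElem? ha)).1
    have hb2 := (hbd b (List.mem_of_getElem? hb)).2
    suffices ∃ q, m.1 ≤ q ∧ q ≤ m.2 ∧ varAt α q = x by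
      obtain ⟨q, hq1, hq2, rfl⟩ := this
      exact Finset.mem_coe.2 (Finset.mem_image_of_mem _ (Finset.mem_Icc.2 ⟨hq1, hq2⟩))
    rcases le_or_gt m.1 a.1 with hle | hlt
    · exact ⟨a.1, hle, ha1, hax⟩
    rcases le_or_gt b.1 m.2 with hle' | hlt'
    · exact ⟨b.1, hb1, hle', hbx⟩
    -- The first occurrence `d` after the window has not been visited by the right head yet, so
    -- the previous occurrence still has to be visited by the left head.
    have hex : ∃ d, m.2 < d ∧ varAt α d = x := ⟨b.1, hlt', hbx⟩
    obtain ⟨hd1, hd2⟩ := Nat.find_spec hex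
    have hdle := Nat.find_min' hex ⟨hlt', hbx⟩
    set d := Nat.find hex with hd
    have h5 := le_prevOcc (α := α) (r := d) ha2 (by omega) (hax.trans hd2.symm)
    have h6 := prevOcc_lt (α := α) (r := d) (by omega)
    have h7 := varAt_prevOcc (α := α) (r := d) (by omega)
    have h8 : prevOcc α d ≤ m.2 := by
      by_contra hcon
      exact Nat.find_min hex h6 ⟨by omega, by rw [h7, hd2]⟩
    obtain ⟨s, hs1, hs2⟩ := hvisit (prevOcc α d, d)
      (mem_canonicalMatching.2 ⟨by simp only; omega, rfl, by simp only; omega, h6⟩)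
    have hst : t < s := by
      by_contra hcon
      have := hbefore s _ (by omega) hs1
      simp only at this
      omega
    exact ⟨prevOcc α d, hafter (s + 1) _ (by omega) hs2, h8, by rw [h7, hd2]⟩
  have hnot : varAt α E[t].1 ∉ activeAt W t := by
    rintro ⟨_, _, _, _, _, _, hx⟩
    exact hx hz
  have h5 := Set.ncard_le_ncard hsub (Finset.finite_toSet _)
  rw [Set.ncard_insert_of_notMem hnot (finite_activeAt W t), Set.ncard_coe_finset] at h5
  have h6 := card_image_varAt_le hm
  omega

/-! ### Runs of the automata obtained from operating modes -/

/-- `Trace step L s s'`: carrying out the instructions in `L` one after another leads from `s`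
to `s'`. -/
def Trace {τ S : Type*} (step : τ → S → S → Prop) : List τ → S → S → Prop
  | [], s, s' => s = s'
  | t :: L, s, s' => ∃ s₁, step t s s₁ ∧ Trace step L s₁ s'

theorem Trace.append {τ S : Type*} {step : τ → S → S → Prop} {L L' : List τ} {s s₁ s' : S}
    (h : Trace step L s s₁) (h' : Trace step L' s₁ s') : Trace step (L ++ L') s s' := by
  induction L generalizing s with
  | nil => rw [Trace] at h; rwa [h, List.nil_append]
  | cons t L ih =>
    obtain ⟨s₂, h1, h2⟩ := h
    exact ⟨s₂, h1, ih h2⟩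

theorem Trace.imp_of_mem {τ S : Type*} {step step' : τ → S → S → Prop} {L : List τ} {s s' : S}
    (h : Trace step L s s') (himp : ∀ t ∈ L, ∀ s s', step t s s' → step' t s s') :
    Trace step' L s s' := by
  induction L generalizing s with
  | nil => exact h
  | cons t L ih =>
    obtain ⟨s₂, h1, h2⟩ := h
    exact ⟨s₂, himp t (by simp) _ _ h1, ih h2 fun t ht => himp t (by simp [ht])⟩

section

variable {A : Type*} [DecidableEq A]

/-- A single step of an unfinished task, as a relation on head positions. -/
def Task.Step (w : List A) (τ : Task) (h h' : ℕ × ℕ) : Prop :=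
  ∃ r, τ.advance (scanned w h.1) (scanned w h.2) = some r ∧
    h' = moveHeads w.length h.1 h.2 r.1 r.2

/-- A task is carried out completely when the lengths of the factors are given by `U`. -/
def Task.Perform (α : List ℕ) (w : List A) (U : ℕ → ℕ) (τ : Task) (h h' : ℕ × ℕ) : Prop :=
  Trace (Task.Step w) (List.replicate (U (τ.var α)) τ) h h' ∧
    τ.mayLeave α.length (scanned w h'.2) = true

/-- The first variable among the tasks `L` that uses the counter `j`. -/
def nextVar (α : List ℕ) {k : ℕ} (co : ℕ → Fin k) (L : List Task) (j : Fin k) : Option ℕ :=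
  (L.map (Task.var α)).find? fun x => co x = j

theorem nextVar_cons_self (α : List ℕ) {k : ℕ} (co : ℕ → Fin k) (τ : Task) (L : List Task) :
    nextVar α co (τ :: L) (co (τ.var α)) = some (τ.var α) := by
  simp [nextVar]

theorem nextVar_cons_of_ne (α : List ℕ) {k : ℕ} (co : ℕ → Fin k) {τ : Task} (L : List Task)
    {j : Fin k} (h : j ≠ co (τ.var α)) : nextVar α co (τ :: L) j = nextVar α co L j := by
  simp [nextVar, Ne.symm h]

theorem mem_of_nextVar {α : List ℕ} {k : ℕ} {co : ℕ → Fin k} {L : List Task} {j : Fin k} {x : ℕ}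
    (h : nextVar α co L j = some x) : x ∈ L.map (Task.var α) := List.mem_of_find?_eq_some h

/-- Variables that share a counter are not interleaved in the sequence of tasks. -/
def IsConflictFree (α : List ℕ) {k : ℕ} (co : ℕ → Fin k) (T : List Task) : Prop :=
  ∀ x z, x ≠ z → [x, z, x].Sublist (T.map (Task.var α)) → co x ≠ co z

/-- A variable that is still needed keeps its counter. -/
theorem IsConflictFree.nextVar_eq {α : List ℕ} {k : ℕ} {co : ℕ → Fin k} {P L : List Task}
    {τ : Task} (h : IsConflictFree α co (P ++ τ :: L)) (hx : τ.var α ∈ L.map (Task.var α)) :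
    nextVar α co L (co (τ.var α)) = some (τ.var α) := by
  set x := τ.var α with hxdef
  unfold nextVar
  cases hz : (L.map (Task.var α)).find? fun y => co y = co x with
  | none =>
    have := List.find?_eq_none.1 hz x hx
    simp at this
  | some z =>
    obtain ⟨hcz, as, bs, hL, has⟩ := List.find?_eq_some_iff_append.1 hz
    simp only [decide_eq_true_eq] at hcz
    by_contra hne
    have hne' : x ≠ z := fun e => hne (by rw [e])
    refine h x z hne' ?_ hcz.symm
    have hxb : x ∈ bs := by
      rw [hL, List.mem_append, List.mem_cons] at hx
      rcases hx with hx | hx | hx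
      · have := has x hx
        simp at this
      · exact absurd hx hne'
      · exact hx
    rw [List.map_append, List.map_cons, hL, ← hxdef]
    refine List.Sublist.trans ?_ (List.sublist_append_right _ _)
    refine List.Sublist.cons_cons x (List.Sublist.trans ?_ (List.sublist_append_right _ _))
    exact List.Sublist.cons_cons z (List.singleton_sublist.2 hxb)

theorem moveHeads_zero (n h₁ h₂ : ℕ) : moveHeads n h₁ h₂ 0 0 = (h₁, h₂) := by
  unfold moveHeads
  split_ifs <;> simp

variable {α : List ℕ} {ms : List (ℕ × ℕ)} {Δ : List (List (ℕ × Head))} {k : ℕ} {co : ℕ → Fin k}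

/-- The number of a state of the automaton. -/
def stateIndex (s : (automatonOf A α ms Δ co).Q) : ℕ :=
  Fin.val (n := (tasks ms Δ).length + 2) s

/-- The state after `s`, modulo the number of states. -/
def succState (s : (automatonOf A α ms Δ co).Q) : (automatonOf A α ms Δ co).Q :=
  (show Fin ((tasks ms Δ).length + 2) from s) + 1

theorem stateIndex_succState {s : (automatonOf A α ms Δ co).Q}
    (hs : stateIndex s < (tasks ms Δ).length + 1) :
    stateIndex (succState s) = stateIndex s + 1 := by
  have key : ∀ s : Fin ((tasks ms Δ).length + 1 + 1), s.val < (tasks ms Δ).length + 1 →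
      (s + 1).val = s.val + 1 := fun s hs =>
    Fin.val_add_one_of_lt (by rw [Fin.lt_def, Fin.val_last]; exact hs)
  exact key s hs

theorem mem_accept_iff {s : (automatonOf A α ms Δ co).Q} :
    s ∈ (automatonOf A α ms Δ co).accept ↔ stateIndex s = (tasks ms Δ).length + 1 :=
  Fin.ext_iff (a := (s : Fin ((tasks ms Δ).length + 2))) (b := Fin.last _)

theorem automatonOf_δ {p : Fin ((tasks ms Δ).length + 2)} {a b : TapeSymbol A}
    {s : Fin k → CounterMessage} {t : ℕ} {τ : Task} {L : List Task} (hp : p.val = t + 1)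
    (hτ : (tasks ms Δ).drop t = τ :: L) :
    @Eq (Action (Fin ((tasks ms Δ).length + 2)) k) ((automatonOf A α ms Δ co).δ p a b s)
      (match s (co (τ.var α)) with
      | .lt =>
        match τ.advance a b with
        | some (r₁, r₂) => ⟨p, r₁, r₂, fun j => if j = co (τ.var α) then .incr else .keep⟩
        | none => ⟨p, 0, 0, fun _ => .keep⟩
      | .eq =>
        if τ.mayLeave α.length b then
          ⟨p + 1, 0, 0, fun j =>
            if j = co (τ.var α) then
              if τ.var α ∈ L.map (Task.var α) then .incr else .reset
            else .keep⟩
        else ⟨p, 0, 0, fun _ => .keep⟩) := by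
  have h0 : p ≠ 0 := by
    rintro rfl
    exact Nat.succ_ne_zero t hp.symm
  have h1 : (tasks ms Δ)[p.val - 1]? = some τ := by
    have := List.getElem?_drop (xs := tasks ms Δ) (i := t) (j := 0)
    rw [hτ] at this
    rw [hp]
    simpa using this.symm
  have h2 : (tasks ms Δ).drop p.val = L := by
    rw [hp, ← List.drop_drop, hτ]
    rfl
  change (if p = 0 then _ else _) = _
  rw [if_neg h0, h1]
  simp only [h2]

/-- The actions of the automaton while it is concerned with the task `τ`. -/
theorem automatonOf_action {w : List A} {K : Configuration (automatonOf A α ms Δ co).Q k}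
    {t : ℕ} {τ : Task} {L : List Task} (hK : stateIndex K.state = t + 1)
    (hτ : (tasks ms Δ).drop t = τ :: L) :
    (automatonOf A α ms Δ co).action w K =
      if K.value (co (τ.var α)) < K.bound (co (τ.var α)) then
        match τ.advance (scanned w K.h₁) (scanned w K.h₂) with
        | some (r₁, r₂) =>
          ⟨K.state, r₁, r₂, fun j => if j = co (τ.var α) then .incr else .keep⟩
        | none => ⟨K.state, 0, 0, fun _ => .keep⟩
      else if τ.mayLeave α.length (scanned w K.h₂) then
        ⟨succState K.state, 0, 0, fun j =>
          if j = co (τ.var α) then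
            if τ.var α ∈ L.map (Task.var α) then .incr else .reset
          else .keep⟩
      else ⟨K.state, 0, 0, fun _ => .keep⟩ := by
  refine (automatonOf_δ hK hτ).trans ?_
  by_cases hlt : K.value (co (τ.var α)) < K.bound (co (τ.var α))
  · simp only [hlt, if_true]
    rfl
  · simp only [hlt, if_false]
    rfl

/-- What is left to be done in a configuration: finish the first task, whose counter has the value
`v`, and carry out the others. -/
def Completes (α : List ℕ) {k : ℕ} (co : ℕ → Fin k) (w : List A) (U : ℕ → ℕ) (v : Fin k → ℕ) :
    List Task → ℕ × ℕ → ℕ × ℕ → Prop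
  | [], h, h' => h = h'
  | τ :: L, h, h' => ∃ h₁,
      Trace (Task.Step w) (List.replicate (U (τ.var α) - v (co (τ.var α))) τ) h h₁ ∧
      τ.mayLeave α.length (scanned w h₁.2) = true ∧ Trace (Task.Perform α w U) L h₁ h'

theorem completes_zero {w : List A} {U : ℕ → ℕ} {v : Fin k → ℕ} {L : List Task} {h h' : ℕ × ℕ}
    (hv : ∀ j, v j = 0) (hc : Completes α co w U v L h h') :
    Trace (Task.Perform α w U) L h h' := by
  cases L with
  | nil => exact hc
  | cons τ L =>
    obtain ⟨h₁, h1, h2, h3⟩ := hc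
    rw [hv, Nat.sub_zero] at h1
    exact ⟨h₁, ⟨h1, h2⟩, h3⟩

/-- From an accepting run one can read off the lengths of the factors. The induction runs backwards
through the computation, so that the bound of a counter belongs to the variable that uses it
next. -/
theorem exists_completes {w : List A} (hco : IsConflictFree α co (tasks ms Δ))
    {K F : Configuration (automatonOf A α ms Δ co).Q k}
    (hrun : Relation.ReflTransGen ((automatonOf A α ms Δ co).Move w) K F)
    (hF : F.state ∈ (automatonOf A α ms Δ co).accept) :
    ∀ t, stateIndex K.state = t + 1 →
      (∀ j, K.value j ≤ K.bound j ∧ K.bound j ≤ w.length) →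
      (∀ τ L, (tasks ms Δ).drop t = τ :: L → ∀ j, j ≠ co (τ.var α) → K.value j = 0) →
      ∃ U : ℕ → ℕ, (∀ x, U x ≤ w.length) ∧
        (∀ j x, nextVar α co ((tasks ms Δ).drop t) j = some x → K.bound j = U x) ∧
        ∃ h', Completes α co w U K.value ((tasks ms Δ).drop t) (K.h₁, K.h₂) h' := by
  have hnil : ∀ (K : Configuration (automatonOf A α ms Δ co).Q k) t,
      (tasks ms Δ).drop t = [] → ∃ U : ℕ → ℕ, (∀ x, U x ≤ w.length) ∧
        (∀ j x, nextVar α co ((tasks ms Δ).drop t) j = some x → K.bound j = U x) ∧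
        ∃ h', Completes α co w U K.value ((tasks ms Δ).drop t) (K.h₁, K.h₂) h' := by
    intro K t ht
    refine ⟨fun _ => 0, by simp, ?_, (K.h₁, K.h₂), ?_⟩
    · rw [ht]; intro j x hx; simp [nextVar] at hx
    · rw [ht]; rfl
  induction hrun using Relation.ReflTransGen.head_induction_on with
  | refl =>
    intro t ht _ _
    refine hnil _ _ (List.drop_eq_nil_of_le ?_)
    rw [mem_accept_iff] at hF
    omega
  | @head K K' hmove _ ih =>
    intro t ht hb hz
    cases hτ : (tasks ms Δ).drop t with
    | nil => rw [← hτ]; exact hnil K t hτ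
    | cons τ L =>
      have htl : t < (tasks ms Δ).length := by
        by_contra hcon
        rw [List.drop_eq_nil_of_le (by omega)] at hτ
        simp at hτ
      have hL : (tasks ms Δ).drop (t + 1) = L := by
        rw [← List.drop_drop, hτ]
        rfl
      have hco' : IsConflictFree α co ((tasks ms Δ).take t ++ τ :: L) := by
        rwa [← hτ, List.take_append_drop]
      have hz' := hz τ L hτ
      set x := τ.var α with hx
      obtain ⟨hs, hh, hc⟩ := hmove
      rw [automatonOf_action ht hτ, ← hx] at hs hh hc
      have hstuck : K'.state = K.state → (K'.h₁, K'.h₂) = (K.h₁, K.h₂) →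
          (∀ j, CounterStep w.length .keep (K.value j) (K.bound j) (K'.value j) (K'.bound j)) →
          ∃ U : ℕ → ℕ, (∀ x, U x ≤ w.length) ∧
          (∀ j x, nextVar α co (τ :: L) j = some x → K.bound j = U x) ∧
          ∃ h', Completes α co w U K.value (τ :: L) (K.h₁, K.h₂) h' := by
        intro h1 h2 h3
        have h4 : K'.bound = K.bound := funext fun j => (h3 j).1
        have h5 : K'.value = K.value := funext fun j => by
          rw [(h3 j).2, Nat.add_zero, Nat.mod_eq_of_lt (Nat.lt_succ_of_le (hb j).1)]
        have := ih t (by rw [h1, ht]) (by rw [h4, h5]; exact hb) (by rw [h5]; exact hz)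
        rwa [hτ, h4, h5, h2] at this
      by_cases hlt : K.value (co x) < K.bound (co x)
      · rw [if_pos hlt] at hs hh hc
        cases hadv : τ.advance (scanned w K.h₁) (scanned w K.h₂) with
        | none =>
          rw [hadv] at hs hh hc
          exact hstuck hs (by rw [hh, moveHeads_zero]) hc
        | some r =>
          rw [hadv] at hs hh hc
          simp only at hs hh hc
          have hbd : ∀ j, K'.bound j = K.bound j := fun j => by
            have := hc j
            split_ifs at this <;> exact this.1
          have hvx : K'.value (co x) = K.value (co x) + 1 := by
            have := hc (co x)
            rw [if_pos rfl] at this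
            rw [this.2, Nat.mod_eq_of_lt (by omega)]
          have hvj : ∀ j, j ≠ co x → K'.value j = 0 := by
            intro j hj
            have := hc j
            rw [if_neg hj] at this
            rw [this.2, hz' j hj]
            simp
          obtain ⟨U, hU, hnext, h', hcomp⟩ := ih t (by rw [hs, ht]) (by
            intro j
            rw [hbd j]
            refine ⟨?_, (hb j).2⟩
            by_cases hj : j = co x
            · rw [hj, hvx]; exact hlt
            · rw [hvj j hj]; exact Nat.zero_le _) (by
            intro τ' L' hτ' j hj
            rw [hτ] at hτ'
            obtain ⟨rfl, -⟩ := List.cons.inj hτ'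
            exact hvj j hj)
          rw [hτ] at hnext hcomp
          refine ⟨U, hU, fun j y hy => by rw [← hbd j]; exact hnext j y hy, h', ?_⟩
          have hUx : K.bound (co x) = U x := by
            rw [← hbd]
            exact hnext _ _ (nextVar_cons_self α co τ L)
          obtain ⟨h₁, hc1, hc2, hc3⟩ := hcomp
          refine ⟨h₁, ?_, hc2, hc3⟩
          rw [← hx] at hc1 ⊢
          rw [hvx] at hc1
          rw [show U x - K.value (co x) = U x - (K.value (co x) + 1) + 1 by omega,
            List.replicate_succ]
          exact ⟨_, ⟨r, hadv, hh⟩, hc1⟩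
      · rw [if_neg hlt] at hs hh hc
        have hveq : K.value (co x) = K.bound (co x) := le_antisymm (hb _).1 (not_lt.1 hlt)
        by_cases hml : τ.mayLeave α.length (scanned w K.h₂) = true
        · rw [if_pos hml] at hs hh hc
          simp only at hs hh hc
          rw [moveHeads_zero] at hh
          have hst : stateIndex K'.state = t + 1 + 1 := by
            rw [hs, stateIndex_succState (by omega), ht]
          have hbj : ∀ j, j ≠ co x → K'.bound j = K.bound j := by
            intro j hj
            have := hc j
            rw [if_neg hj] at this
            exact this.1
          have hbx : K'.bound (co x) ≤ w.length ∧
              (x ∈ L.map (Task.var α) → K'.bound (co x) = K.bound (co x)) := by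
            have := hc (co x)
            rw [if_pos rfl] at this
            split_ifs at this with hmem
            · exact ⟨by rw [this.1]; exact (hb _).2, fun _ => this.1⟩
            · exact ⟨this.1, fun h => absurd h hmem⟩
          have hv0 : ∀ j, K'.value j = 0 := by
            intro j
            have := hc j
            by_cases hj : j = co x
            · rw [if_pos hj] at this
              split_ifs at this with hmem
              · rw [this.2, hj, hveq, Nat.mod_self]
              · exact this.2
            · rw [if_neg hj] at this
              rw [this.2, hz' j hj]
              simp
          obtain ⟨U', hU', hnext, h', hcomp⟩ := ih (t + 1) hst (by
            intro j
            rw [hv0 j]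
            refine ⟨Nat.zero_le _, ?_⟩
            by_cases hj : j = co x
            · rw [hj]; exact hbx.1
            · rw [hbj j hj]; exact (hb j).2) (fun _ _ _ j _ => hv0 j)
          rw [hL] at hnext hcomp
          rw [hh] at hcomp
          have hcomp' := completes_zero hv0 hcomp
          suffices ∃ U : ℕ → ℕ, (∀ x, U x ≤ w.length) ∧ U x = K.bound (co x) ∧
              ∀ y ∈ L.map (Task.var α), U y = U' y by
            obtain ⟨U, hU, hUx, hUy⟩ := this
            refine ⟨U, hU, ?_, h', (K.h₁, K.h₂), ?_, hml, ?_⟩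
            · intro j y hy
              by_cases hj : j = co x
              · rw [hj, hx, nextVar_cons_self, Option.some.injEq] at hy
                rw [← hy, ← hx, hj, hUx]
              · rw [nextVar_cons_of_ne α co L hj] at hy
                rw [hUy y (mem_of_nextVar hy), ← hbj j hj]
                exact hnext j y hy
            · rw [← hx, hUx, hveq, Nat.sub_self]
              rfl
            · refine hcomp'.imp_of_mem fun τ' hτ' s s' hstep => ?_
              unfold Task.Perform at hstep ⊢
              rwa [hUy _ (List.mem_map_of_mem hτ')]
          by_cases hmem : x ∈ L.map (Task.var α)
          · refine ⟨U', hU', ?_, fun _ _ => rfl⟩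
            rw [← hbx.2 hmem]
            exact (hnext _ _ (hco'.nextVar_eq hmem)).symm
          · refine ⟨Function.update U' x (K.bound (co x)), fun y => ?_, by simp, fun y hy => ?_⟩
            · by_cases hy : y = x
              · rw [hy, Function.update_self]; exact (hb _).2
              · rw [Function.update_of_ne hy]; exact hU' y
            · rw [Function.update_of_ne (fun e : y = x => hmem (e ▸ hy))]
        · rw [if_neg hml] at hs hh hc
          exact hstuck hs (by rw [hh, moveHeads_zero]) hc

/-- The bounds to be guessed for the tasks `L`: every counter belongs to the variable that uses it
next. -/
def nextBound (α : List ℕ) {k : ℕ} (co : ℕ → Fin k) (U : ℕ → ℕ) (L : List Task) (j : Fin k) : ℕ :=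
  ((nextVar α co L j).map U).getD 0

theorem nextBound_le {U : ℕ → ℕ} {n : ℕ} (hU : ∀ x, U x ≤ n) (L : List Task) (j : Fin k) :
    nextBound α co U L j ≤ n := by
  unfold nextBound
  cases nextVar α co L j <;> simp [hU]

/-- A sequence of performed tasks gives an accepting run in which every counter is reset to the
bound that its next variable needs. -/
theorem exists_run_of_trace {w : List A} (hco : IsConflictFree α co (tasks ms Δ)) {U : ℕ → ℕ}
    (hU : ∀ x, U x ≤ w.length) {P L : List Task} (hT : tasks ms Δ = P ++ L) {h h' : ℕ × ℕ}
    (htr : Trace (Task.Perform α w U) L h h')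
    {s : (automatonOf A α ms Δ co).Q} (hs : stateIndex s = P.length + 1) :
    ∃ F : Configuration (automatonOf A α ms Δ co).Q k,
      Relation.ReflTransGen ((automatonOf A α ms Δ co).Move w)
        ⟨s, h.1, h.2, fun _ => 0, nextBound α co U L⟩ F ∧
      F.state ∈ (automatonOf A α ms Δ co).accept := by
  induction L generalizing P h s with
  | nil =>
    refine ⟨_, Relation.ReflTransGen.refl, ?_⟩
    rw [mem_accept_iff, hs, hT, List.append_nil]
  | cons τ L ih =>
    obtain ⟨h₁, ⟨hstep, hleave⟩, htr⟩ := htr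
    have hdrop : (tasks ms Δ).drop P.length = τ :: L := by rw [hT]; simp
    set x := τ.var α with hx
    have hbx : nextBound α co U (τ :: L) (co x) = U x := by
      rw [nextBound, hx, nextVar_cons_self]
      rfl
    have hco' : IsConflictFree α co (P ++ τ :: L) := hT ▸ hco
    have hinner : ∀ d v h, v + d = U x →
        Trace (Task.Step w) (List.replicate d τ) h h₁ →
        Relation.ReflTransGen ((automatonOf A α ms Δ co).Move w)
          ⟨s, h.1, h.2, Function.update (fun _ => 0) (co x) v, nextBound α co U (τ :: L)⟩
          ⟨s, h₁.1, h₁.2, Function.update (fun _ => 0) (co x) (U x),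
            nextBound α co U (τ :: L)⟩ := by
      intro d
      induction d with
      | zero =>
        intro v h hv hd
        have hd : h = h₁ := hd
        rw [hd, ← hv, Nat.add_zero]
      | succ d ihd =>
        intro v h hv hd
        rw [List.replicate_succ] at hd
        obtain ⟨h₂, ⟨r, hadv, hr⟩, hd⟩ := hd
        refine Relation.ReflTransGen.head ?_ (ihd (v + 1) h₂ (by omega) hd)
        unfold Automaton.Move
        rw [automatonOf_action hs hdrop, ← hx]
        simp only [Function.update_self, hbx]
        rw [if_pos (by omega), hadv]
        refine ⟨rfl, hr, fun j => ?_⟩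
        simp only
        by_cases hj : j = co x
        · rw [if_pos hj, hj, Function.update_self, Function.update_self, hbx]
          exact ⟨rfl, (Nat.mod_eq_of_lt (by omega)).symm⟩
        · rw [if_neg hj, Function.update_of_ne hj, Function.update_of_ne hj]
          exact ⟨rfl, by simp⟩
    obtain ⟨F, hF, hacc⟩ := ih (P := P ++ [τ]) (by simp [hT]) htr (s := succState s)
      (by rw [stateIndex_succState (by rw [hs, hT]; simp), hs]; simp)
    refine ⟨F, ?_, hacc⟩
    have h1 := hinner (U x) 0 h (by omega) hstep
    rw [Function.update_eq_self] at h1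
    refine h1.trans (Relation.ReflTransGen.head ?_ hF)
    unfold Automaton.Move
    rw [automatonOf_action hs hdrop, ← hx]
    simp only [Function.update_self, hbx]
    rw [if_neg (lt_irrefl _), if_pos hleave]
    refine ⟨rfl, by rw [moveHeads_zero], fun j => ?_⟩
    simp only
    by_cases hj : j = co x
    · rw [if_pos hj, hj, Function.update_self, hbx]
      split_ifs with hmem
      · refine ⟨?_, (Nat.mod_self _).symm⟩
        rw [nextBound, hco'.nextVar_eq hmem]
        rfl
      · exact ⟨nextBound_le hU L _, rfl⟩
    · rw [if_neg hj, Function.update_of_ne hj]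
      refine ⟨?_, by simp⟩
      rw [nextBound, nextBound, nextVar_cons_of_ne α co L hj]

/-- Acceptance does not depend on the counters any more, but only on a choice of factor lengths. -/
theorem mem_language_automatonOf_iff {w : List A} (hco : IsConflictFree α co (tasks ms Δ)) :
    w ∈ (automatonOf A α ms Δ co).language ↔ ∃ U : ℕ → ℕ, (∀ x, U x ≤ w.length) ∧
      ∃ h', Trace (Task.Perform α w U) (tasks ms Δ) (1, 1) h' := by
  have hact : (automatonOf A α ms Δ co).action w (automatonOf A α ms Δ co).initial =
      ⟨succState (automatonOf A α ms Δ co).start, 1, 1, fun _ => .reset⟩ := by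
    simp [Automaton.action, Automaton.initial, automatonOf, scanned, succState]
  have hval : stateIndex (succState (automatonOf A α ms Δ co).start) = 0 + 1 :=
    stateIndex_succState (Nat.succ_pos _)
  have hmv : moveHeads w.length 0 0 1 1 = (1, 1) := by
    simp [moveHeads]
  constructor
  · rintro ⟨F, hrun, hF⟩
    rcases Relation.ReflTransGen.cases_head hrun with rfl | ⟨K, hmove, hrun⟩
    · exact absurd (mem_accept_iff.1 hF) (Nat.succ_ne_zero _).symm
    · obtain ⟨hs, hh, hc⟩ := hmove
      rw [hact] at hs hh hc
      have hh' : (K.h₁, K.h₂) = (1, 1) := hh.trans hmv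
      have hv0 : ∀ j, K.value j = 0 := fun j => (hc j).2
      obtain ⟨U, hU, -, h', hcomp⟩ := exists_completes hco hrun hF 0 (by rw [hs, hval])
        (fun j => ⟨by rw [hv0 j]; exact Nat.zero_le _, (hc j).1⟩) (fun _ _ _ j _ => hv0 j)
      rw [hh', List.drop_zero] at hcomp
      exact ⟨U, hU, h', completes_zero hv0 hcomp⟩
  · rintro ⟨U, hU, h', htr⟩
    obtain ⟨F, hF, hacc⟩ := exists_run_of_trace hco hU (P := []) (L := tasks ms Δ) rfl htr hval
    refine ⟨F, Relation.ReflTransGen.head ?_ hF, hacc⟩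
    unfold Automaton.Move
    rw [hact]
    exact ⟨rfl, hmv.symm, fun j => ⟨nextBound_le hU _ j, rfl⟩⟩

end

theorem flatMap_sublist_flatMap {β γ : Type*} {L : List β} {f g : β → List γ}
    (h : ∀ b ∈ L, (f b).Sublist (g b)) : (L.flatMap f).Sublist (L.flatMap g) := by
  induction L with
  | nil => simp
  | cons b L ih =>
    rw [List.flatMap_cons, List.flatMap_cons]
    exact (h b (by simp)).append (ih fun b hb => h b (by simp [hb]))

theorem var_moveTask (α : List ℕ) (m m' : ℕ × ℕ) (e : ℕ × Head) :
    (moveTask m m' e).var α = varAt α e.1 := by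
  obtain ⟨q, μ⟩ := e
  cases μ <;> simp only [moveTask] <;> split_ifs <;> rfl

theorem tasksOf_append (m m' : ℕ × ℕ) (D : List (ℕ × Head)) (e e' : ℕ × Head) :
    tasksOf m m' (D ++ [e, e']) = D.map (moveTask m m') ++ [.compare m'.1 m'.2] := by
  simp [tasksOf]

/-- The variables of the tasks form a subsequence of the movement word, since the two entries for a
comparison become a single task. -/
theorem IsCounterAssignment.isConflictFree {α : List ℕ} {ms : List (ℕ × ℕ)}
    {Δ : List (List (ℕ × Head))} {k : ℕ} {co : ℕ → Fin k} (h : IsCounterAssignment α Δ co)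
    (hΔ : IsOperatingMode α ms Δ) : IsConflictFree α co (tasks ms Δ) := by
  intro x z hxz hsub
  refine h x z hxz (exists_factorisation_of_sublist (hsub.trans ?_))
  have e : Δ = (List.range ms.length).map fun i => Δ.getD i [] := by
    refine List.ext_getElem (by simp [hΔ.2.1]) fun i h1 h2 => ?_
    simp [h1]
  have e' : Δ.flatten = (List.range ms.length).flatMap fun i => Δ.getD i [] := by
    rw [List.flatMap_def, ← e]
  rw [movementWord, e', tasks, List.map_flatMap, List.map_flatMap]
  refine flatMap_sublist_flatMap fun i hi => ?_
  obtain ⟨D, -, hD⟩ := hΔ.2.2 i (List.mem_range.1 hi)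
  have hget : Δ.getD i [] = D ++ [((matchingPos ms i).2, .right),
      ((matchingPos ms i).1, .left)] := by
    rw [List.getD_eq_getElem?_getD, hD]; rfl
  rw [hget, tasksOf_append, List.map_append, List.map_append, List.map_map]
  have : Task.var α ∘ moveTask (previousPos ms i) (matchingPos ms i) =
      fun e => varAt α e.1 := funext fun e => var_moveTask α _ _ e
  rw [this]
  refine List.Sublist.append (List.Sublist.refl _) ?_
  simp [Task.var]

/-! ### Tasks in terms of factors -/

/-- The effect of a task on the pair of the numbers of factors to the left of the two heads. The
side conditions keep the left head from overtaking the right one. -/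
inductive FactorStep (α : List ℕ) : Task → ℕ × ℕ → ℕ × ℕ → Prop where
  | forthLeft {q b : ℕ} : q + 1 ≤ b → b ≤ α.length →
      FactorStep α (.forth .left (q + 1)) (q, b) (q + 1, b)
  | forthRight {a q : ℕ} : a ≤ q → q + 1 ≤ α.length →
      FactorStep α (.forth .right (q + 1)) (a, q) (a, q + 1)
  | backLeft {q b : ℕ} : q + 1 ≤ b → b ≤ α.length →
      FactorStep α (.back .left (q + 1)) (q + 1, b) (q, b)
  | compare {l r : ℕ} : l < r → r + 1 ≤ α.length → varAt α (l + 1) = varAt α (r + 1) →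
      FactorStep α (.compare (l + 1) (r + 1)) (l, r) (l + 1, r + 1)

theorem trace_forthLeft {α : List ℕ} {a b : ℕ} (n : ℕ) (h : a + n ≤ b) (hb : b ≤ α.length) :
    Trace (FactorStep α) ((List.range' (a + 1) n).map (.forth .left)) (a, b) (a + n, b) := by
  induction n generalizing a with
  | zero => rfl
  | succ n ih =>
    rw [List.range'_succ, List.map_cons]
    refine ⟨_, .forthLeft (by omega) hb, ?_⟩
    have := ih (a := a + 1) (by omega)
    rwa [show a + 1 + n = a + (n + 1) by omega] at this

theorem trace_forthRight {α : List ℕ} {a b : ℕ} (n : ℕ) (h : a ≤ b) (hb : b + n ≤ α.length) :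
    Trace (FactorStep α) ((List.range' (b + 1) n).map (.forth .right)) (a, b) (a, b + n) := by
  induction n generalizing b with
  | zero => rfl
  | succ n ih =>
    rw [List.range'_succ, List.map_cons]
    refine ⟨_, .forthRight h (by omega), ?_⟩
    have := ih (b := b + 1) (by omega) (by omega)
    rwa [show b + 1 + n = b + (n + 1) by omega] at this

theorem trace_backLeft {α : List ℕ} {a b : ℕ} (n : ℕ) (h : a + n ≤ b) (hb : b ≤ α.length) :
    Trace (FactorStep α) ((List.range' (a + 1) n).reverse.map (.back .left)) (a + n, b)
      (a, b) := by
  induction n with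
  | zero => rfl
  | succ n ih =>
    rw [List.range'_1_concat, List.reverse_append, List.reverse_singleton, List.singleton_append,
      List.map_cons, show a + 1 + n = a + n + 1 by omega]
    exact ⟨_, .backLeft (by omega) hb, ih (by omega)⟩

/-- One round of the canonical mode leads from one matching position to the next one. -/
theorem trace_canonicalBlock {α : List ℕ} {m m' : ℕ × ℕ} (hm : m.1 ≤ m.2) (hl : 1 ≤ m'.1)
    (hm' : m'.1 < m'.2) (hr : m.2 < m'.2) (hα : m'.2 ≤ α.length)
    (hv : varAt α m'.1 = varAt α m'.2) :
    Trace (FactorStep α) ((canonicalBlock m m').map (moveTask m m') ++ [.compare m'.1 m'.2])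
      m m' := by
  obtain ⟨l, r⟩ := m
  obtain ⟨l', r'⟩ := m'
  simp only at hm hl hm' hr hα hv ⊢
  have hleft : ∀ L : List ℕ, (L.map (·, Head.left)).map (moveTask (l, r) (l', r')) =
      L.map (if l < l' then .forth .left else .back .left) := by
    intro L
    rw [List.map_map]
    refine List.map_congr_left fun q _ => ?_
    simp only [Function.comp, moveTask]
    split_ifs <;> rfl
  have hright : ∀ L : List ℕ, (L.map (·, Head.right)).map (moveTask (l, r) (l', r')) =
      L.map (.forth .right) := by
    intro L
    rw [List.map_map]
    refine List.map_congr_left fun q _ => ?_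
    simp [Function.comp, moveTask, hr]
  rw [canonicalBlock, List.map_append, List.map_append, hleft, hleft, hright]
  set p := min l' (r + 1) - 1 with hp
  have hearly : Trace (FactorStep α) ((earlyMoves (l, r) (l', r')).map
      (if l < l' then .forth .left else .back .left)) (l, r) (p, r) := by
    unfold earlyMoves passed
    simp only
    rcases lt_or_ge l l' with hlt | hge
    · rw [if_pos hlt, if_pos (by omega)]
      have := trace_forthLeft (α := α) (a := l) (b := r) (min l' (r + 1) - l - 1)
        (by omega) (by omega)
      rwa [show l + (min l' (r + 1) - l - 1) = p by omega] at this
    · rw [if_neg (by omega), if_neg (by omega)]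
      have := trace_backLeft (α := α) (a := l' - 1) (b := r) (l - l' + 1)
        (by omega) (by omega)
      rwa [show l' - 1 + 1 = l' by omega, show l' - 1 + (l - l' + 1) = l by omega,
        show l' - 1 = p by omega, show l' = min l' (r + 1) by omega] at this
  have hmid : Trace (FactorStep α) ((passed r r').map (.forth .right)) (p, r) (p, r' - 1) := by
    rw [passed, if_pos hr]
    have := trace_forthRight (α := α) (a := p) (b := r) (r' - r - 1) (by omega) (by omega)
    rwa [show r + (r' - r - 1) = r' - 1 by omega] at this
  have hlate : Trace (FactorStep α) ((lateMoves (l, r) (l', r')).map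
      (if l < l' then .forth .left else .back .left)) (p, r' - 1) (l' - 1, r' - 1) := by
    unfold lateMoves
    simp only
    rcases le_or_gt l' (r + 1) with hle | hgt
    · rw [show l' - 1 - r = 0 by omega, show p = l' - 1 by omega]
      rfl
    · rw [if_pos (by omega), show p = r by omega]
      have := trace_forthLeft (α := α) (a := r) (b := r' - 1) (l' - 1 - r) (by omega) (by omega)
      rwa [show r + (l' - 1 - r) = l' - 1 by omega] at this
  refine (hearly.append (hmid.append hlate)).append ?_
  refine ⟨(l', r'), ?_, rfl⟩
  obtain ⟨l, rfl⟩ : ∃ i, l' = i + 1 := ⟨l' - 1, by omega⟩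
  obtain ⟨r, rfl⟩ : ∃ i, r' = i + 1 := ⟨r' - 1, by omega⟩
  exact .compare (by omega) hα hv

theorem trace_canonicalMode (α : List ℕ) :
    ∃ s, Trace (FactorStep α) (tasks (canonicalMatching α) (canonicalMode α)) (0, 0) s := by
  set ms := canonicalMatching α with hms
  refine ⟨previousPos ms ms.length, ?_⟩
  have key : ∀ j ≤ ms.length, Trace (FactorStep α) ((List.range j).flatMap fun i =>
      tasksOf (previousPos ms i) (matchingPos ms i) ((canonicalMode α).getD i [])) (0, 0)
      (previousPos ms j) := by
    intro j
    induction j with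
    | zero => exact fun _ => rfl
    | succ j ih =>
      intro hj
      rw [List.range_succ, List.flatMap_append, List.flatMap_singleton, previousPos_succ]
      refine (ih (by omega)).append ?_
      have hget : (canonicalMode α).getD j [] =
          canonicalBlock (previousPos ms j) (matchingPos ms j) ++
            [((matchingPos ms j).2, .right), ((matchingPos ms j).1, .left)] := by
        simp [canonicalMode, ← hms, show j < ms.length by omega]
      rw [hget, tasksOf_append]
      have hmem : matchingPos ms j ∈ ms := matchingPos_mem (by omega)
      obtain ⟨h1, h2⟩ := previousPos_canonicalMatching (α := α) (i := j) (by rw [← hms]; omega)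
      obtain ⟨h3, -, h4, h5⟩ := mem_canonicalMatching.1 hmem
      exact trace_canonicalBlock h1 h4 h5 h2 h3 (varAt_eq_of_mem_canonicalMatching hmem)
  exact key _ le_rfl

theorem compare_mem_tasks {ms : List (ℕ × ℕ)} {Δ : List (List (ℕ × Head))} {m : ℕ × ℕ}
    (hm : m ∈ ms) : Task.compare m.1 m.2 ∈ tasks ms Δ := by
  obtain ⟨i, hi, rfl⟩ := exists_matchingPos_eq hm
  exact List.mem_flatMap.2 ⟨i, List.mem_range.2 hi, by simp [tasksOf]⟩

/-! ### Head positions -/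

theorem moveHeads_eq {n h₁ h₂ h₁' h₂' : ℕ} {r₁ r₂ : SignType} (h1 : (h₁ : ℤ) + r₁ = h₁')
    (h2 : (h₂ : ℤ) + r₂ = h₂') (h12 : h₁' ≤ h₂') (hn : h₂' ≤ n + 1) :
    moveHeads n h₁ h₂ r₁ r₂ = (h₁', h₂') := by
  unfold moveHeads
  rw [h1, h2, if_pos (by omega)]
  simp

section

variable {A : Type*}

theorem scanned_succ_of_lt {w : List A} {h : ℕ} (hh : h < w.length) :
    scanned w (h + 1) = .letter w[h] := by
  simp [scanned, hh]

theorem scanned_succ_of_ge {w : List A} {h : ℕ} (hh : w.length ≤ h) :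
    scanned w (h + 1) = .rightEnd := by
  simp [scanned, hh]

variable [DecidableEq A] {w : List A}

theorem step_forthLeft {q a b : ℕ} {h' : ℕ × ℕ} (hab : a + 1 ≤ b) (hb : b ≤ w.length) :
    Task.Step w (.forth .left q) (a + 1, b + 1) h' ↔ h' = (a + 2, b + 1) := by
  unfold Task.Step
  rw [scanned_succ_of_lt (show a < w.length by omega)]
  simp only [Task.advance, Option.some.injEq, exists_eq_left']
  rw [moveHeads_eq (h₁' := a + 2) (h₂' := b + 1) (by simp; ring) (by simp) (by omega) (by omega)]

theorem step_forthRight {q a b : ℕ} {h' : ℕ × ℕ} (hab : a ≤ b) (hb : b ≤ w.length) :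
    Task.Step w (.forth .right q) (a + 1, b + 1) h' ↔
      b + 1 ≤ w.length ∧ h' = (a + 1, b + 2) := by
  unfold Task.Step
  rcases hb.eq_or_lt with rfl | hlt
  · rw [scanned_succ_of_ge le_rfl]
    simp [Task.advance]
  · rw [scanned_succ_of_lt hlt]
    simp only [Task.advance, Option.some.injEq, exists_eq_left']
    rw [moveHeads_eq (h₁' := a + 1) (h₂' := b + 2) (by simp) (by simp; ring) (by omega) (by omega)]
    simp [Nat.succ_le_of_lt hlt]

theorem step_backLeft {q a b : ℕ} {h' : ℕ × ℕ} (hab : a + 1 ≤ b) (hb : b ≤ w.length) :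
    Task.Step w (.back .left q) (a + 2, b + 1) h' ↔ h' = (a + 1, b + 1) := by
  unfold Task.Step
  have hadv : (Task.back .left q).advance (scanned w (a + 2)) (scanned w (b + 1)) =
      some (-1, 0) := by
    rcases lt_or_ge (a + 1) w.length with hlt | hge
    · rw [scanned_succ_of_lt hlt]; rfl
    · rw [scanned_succ_of_ge hge]; rfl
  simp only [hadv, Option.some.injEq, exists_eq_left']
  rw [moveHeads_eq (h₁' := a + 1) (h₂' := b + 1) (by simp; ring) (by simp) (by omega) (by omega)]

theorem step_compare {l r a b : ℕ} {h' : ℕ × ℕ} (hab : a ≤ b) (hb : b ≤ w.length) :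
    Task.Step w (.compare l r) (a + 1, b + 1) h' ↔
      b + 1 ≤ w.length ∧ w[a]? = w[b]? ∧ h' = (a + 2, b + 2) := by
  unfold Task.Step
  rcases hb.eq_or_lt with rfl | hlt
  · simp only [scanned_succ_of_ge le_rfl]
    cases scanned w (a + 1) <;> simp [Task.advance]
  · have hlt' : a < w.length := by omega
    simp only [scanned_succ_of_lt hlt, scanned_succ_of_lt hlt', Task.advance,
      List.getElem?_eq_getElem hlt, List.getElem?_eq_getElem hlt', Option.some.injEq]
    by_cases heq : w[a] = w[b]
    · rw [if_pos heq]
      simp only [Option.some.injEq, exists_eq_left']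
      rw [moveHeads_eq (h₁' := a + 2) (h₂' := b + 2) (by simp; ring) (by simp; ring) (by omega)
        (by omega)]
      simp [Nat.succ_le_of_lt hlt, heq]
    · simp [heq]

theorem trace_replicate_forthLeft {q a b : ℕ} {h' : ℕ × ℕ} (u : ℕ) (hab : a + u ≤ b)
    (hb : b ≤ w.length) :
    Trace (Task.Step w) (List.replicate u (.forth .left q)) (a + 1, b + 1) h' ↔
      h' = (a + u + 1, b + 1) := by
  induction u generalizing a with
  | zero => exact eq_comm
  | succ u ih =>
    rw [List.replicate_succ, Trace]
    simp only [step_forthLeft (show a + 1 ≤ b by omega) hb, exists_eq_left]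
    rw [ih (a := a + 1) (by omega), show a + 1 + u + 1 = a + (u + 1) + 1 by omega]

theorem trace_replicate_forthRight {q a b : ℕ} {h' : ℕ × ℕ} (u : ℕ) (hab : a ≤ b)
    (hb : b ≤ w.length) :
    Trace (Task.Step w) (List.replicate u (.forth .right q)) (a + 1, b + 1) h' ↔
      b + u ≤ w.length ∧ h' = (a + 1, b + u + 1) := by
  induction u generalizing b with
  | zero =>
    rw [and_iff_right (show b + 0 ≤ w.length from hb)]
    exact eq_comm
  | succ u ih =>
    rw [List.replicate_succ, Trace]
    simp only [step_forthRight hab hb, and_assoc, exists_and_left, exists_eq_left]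
    constructor
    · rintro ⟨h1, h2⟩
      rw [ih (b := b + 1) (by omega) h1, show b + 1 + u = b + (u + 1) by omega] at h2
      exact h2
    · rintro ⟨h1, h2⟩
      refine ⟨by omega, ?_⟩
      rw [ih (b := b + 1) (by omega) (by omega), show b + 1 + u = b + (u + 1) by omega]
      exact ⟨h1, h2⟩

theorem trace_replicate_backLeft {q a b : ℕ} {h' : ℕ × ℕ} (u : ℕ) (hab : a + u ≤ b)
    (hb : b ≤ w.length) :
    Trace (Task.Step w) (List.replicate u (.back .left q)) (a + u + 1, b + 1) h' ↔
      h' = (a + 1, b + 1) := by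
  induction u with
  | zero => exact eq_comm
  | succ u ih =>
    rw [List.replicate_succ, Trace]
    simp only [show a + (u + 1) + 1 = a + u + 2 by omega,
      step_backLeft (show a + u + 1 ≤ b by omega) hb, exists_eq_left]
    rw [ih (by omega)]

theorem trace_replicate_compare {l r a b : ℕ} {h' : ℕ × ℕ} (u : ℕ) (hab : a ≤ b)
    (hb : b ≤ w.length) :
    Trace (Task.Step w) (List.replicate u (.compare l r)) (a + 1, b + 1) h' ↔
      b + u ≤ w.length ∧ (∀ i < u, w[a + i]? = w[b + i]?) ∧ h' = (a + u + 1, b + u + 1) := by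
  induction u generalizing a b with
  | zero =>
    rw [and_iff_right (show b + 0 ≤ w.length from hb), and_iff_right (by simp)]
    exact eq_comm
  | succ u ih =>
    rw [List.replicate_succ, Trace]
    simp only [step_compare hab hb, and_assoc, exists_and_left, exists_eq_left]
    have hall : (∀ i < u + 1, w[a + i]? = w[b + i]?) ↔
        w[a]? = w[b]? ∧ ∀ i < u, w[a + 1 + i]? = w[b + 1 + i]? := by
      simp only [Nat.lt_succ_iff, add_assoc, Nat.add_comm 1]
      constructor
      · exact fun h => ⟨h 0 (Nat.zero_le _), fun i hi => h (i + 1) hi⟩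
      · rintro ⟨h0, h⟩ i hi
        cases i with
        | zero => exact h0
        | succ i => exact h i hi
    rw [hall, and_assoc]
    constructor
    · rintro ⟨h1, h2, h3⟩
      rw [ih (a := a + 1) (b := b + 1) (by omega) h1] at h3
      refine ⟨by omega, h2, h3.2.1, ?_⟩
      rw [h3.2.2, show a + 1 + u = a + (u + 1) by omega, show b + 1 + u = b + (u + 1) by omega]
    · rintro ⟨h1, h2, h3, h4⟩
      refine ⟨by omega, h2, ?_⟩
      rw [ih (a := a + 1) (b := b + 1) (by omega) (by omega)]
      refine ⟨by omega, h3, ?_⟩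
      rw [h4, show a + 1 + u = a + (u + 1) by omega, show b + 1 + u = b + (u + 1) by omega]

end

/-! ### Factorisations of words -/

/-- The total length of the first `j` factors if the factors have the lengths given by `U`. -/
def prefixLength (α : List ℕ) (U : ℕ → ℕ) (j : ℕ) : ℕ := ((α.take j).map U).sum

theorem prefixLength_succ {α : List ℕ} (U : ℕ → ℕ) {j : ℕ} (hj : j + 1 ≤ α.length) :
    prefixLength α U (j + 1) = prefixLength α U j + U (varAt α (j + 1)) := by
  unfold prefixLength varAt
  rw [List.take_add_one, List.getElem?_eq_getElem (by omega), Nat.add_sub_cancel,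
    List.getD_eq_getElem _ _ (by omega)]
  simp only [Option.toList_some, List.map_append, List.map_cons, List.map_nil, List.sum_append,
    List.sum_singleton]

theorem prefixLength_mono {α : List ℕ} (U : ℕ → ℕ) {i j : ℕ} (hij : i ≤ j) (hj : j ≤ α.length) :
    prefixLength α U i ≤ prefixLength α U j := by
  induction j, hij using Nat.le_induction with
  | base => exact le_rfl
  | succ j _ ih =>
    rw [prefixLength_succ U hj]
    exact (ih (by omega)).trans (Nat.le_add_right _ _)

section

variable {A : Type*} {α : List ℕ} {w : List A}

/-- If consecutive occurrences of every variable carry equal factors, then the word is an image of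
the pattern. -/
theorem mem_patternLanguage_of_factors {U : ℕ → ℕ} (hlen : prefixLength α U α.length = w.length)
    (h : ∀ m ∈ canonicalMatching α, ∀ i < U (varAt α m.1),
      w[prefixLength α U (m.1 - 1) + i]? = w[prefixLength α U (m.2 - 1) + i]?) :
    w ∈ patternLanguage A α := by
  set F : ℕ → List A := fun q => (w.drop (prefixLength α U (q - 1))).take (U (varAt α q)) with hF
  have hmatch : ∀ m ∈ canonicalMatching α, F m.1 = F m.2 := by
    intro m hm
    have hv := varAt_eq_of_mem_canonicalMatching hm
    refine List.ext_getElem? fun i => ?_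
    simp only [hF, List.getElem?_take, List.getElem?_drop, ← hv]
    split_ifs with hi
    · exact h m hm i hi
    · rfl
  have hconst : ∀ q' q, 1 ≤ q → q ≤ q' → q' ≤ α.length → varAt α q = varAt α q' → F q = F q' := by
    intro q'
    induction q' using Nat.strong_induction_on with
    | _ q' ih =>
      intro q hq hqq' hq' hv
      rcases hqq'.eq_or_lt with rfl | hlt
      · rfl
      have h1 := le_prevOcc hq hlt hv
      have h2 := prevOcc_lt (α := α) (r := q') (by omega)
      have h3 := varAt_prevOcc (α := α) (r := q') (by omega)
      rw [ih _ h2 q hq h1 (by omega) (hv.trans h3.symm)]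
      exact hmatch (prevOcc α q', q')
        (mem_canonicalMatching.2 ⟨hq', rfl, by simp only; omega, h2⟩)
  set σ : ℕ → List A := fun x => F (sInf (varpos α x)) with hσ
  have hFσ : ∀ q, 1 ≤ q → q ≤ α.length → F q = σ (varAt α q) := by
    intro q h1 h2
    have hq : q ∈ varpos α (varAt α q) := ⟨h1, h2, rfl⟩
    have hmem := Nat.sInf_mem ⟨q, hq⟩
    exact (hconst q _ hmem.1 (Nat.sInf_le hq) h2 hmem.2.2).symm
  have key : ∀ j ≤ α.length, w.take (prefixLength α U j) = (α.take j).flatMap σ := by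
    intro j
    induction j with
    | zero => intro _; simp [prefixLength]
    | succ j ih =>
      intro hj
      rw [prefixLength_succ U hj, List.take_add, ih (by omega), List.take_add_one,
        List.getElem?_eq_getElem (by omega), List.flatMap_append]
      congr 1
      have := hFσ (j + 1) (by omega) hj
      have hvar : varAt α (j + 1) = α[j] := by simp [varAt, show j < α.length by omega]
      rw [← hvar]
      simpa [hF] using this
  have := key α.length le_rfl
  rw [hlen, List.take_length, List.take_length] at this
  exact ⟨σ, this⟩

/-- In an image of the pattern, any two positions of a variable carry equal factors. -/
theorem exists_verified_of_mem_patternLanguage (hw : w ∈ patternLanguage A α) :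
    ∃ U : ℕ → ℕ, (∀ x, U x ≤ w.length) ∧ prefixLength α U α.length = w.length ∧
      ∀ l r, 1 ≤ l → l ≤ α.length → 1 ≤ r → r ≤ α.length → varAt α l = varAt α r →
        ∀ i < U (varAt α l),
          w[prefixLength α U (l - 1) + i]? = w[prefixLength α U (r - 1) + i]? := by
  obtain ⟨σ, rfl⟩ := hw
  set w := α.flatMap σ with hw
  -- The counters hold numbers of at most `|w|`, so variables outside of `α` get a smaller length.
  set U : ℕ → ℕ := fun x => min (σ x).length w.length with hU
  have hUα : ∀ x ∈ α, U x = (σ x).length := by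
    intro x hx
    refine min_eq_left ?_
    obtain ⟨s, t, hst⟩ := List.append_of_mem hx
    rw [hw, hst, List.flatMap_append, List.flatMap_cons]
    simp only [List.length_append]
    omega
  have hP : ∀ j, prefixLength α U j = ((α.take j).flatMap σ).length := by
    intro j
    rw [prefixLength, List.length_flatMap]
    congr 1
    exact List.map_congr_left fun x hx => hUα x (List.mem_of_mem_take hx)
  have hget : ∀ q, 1 ≤ q → q ≤ α.length → ∀ i < U (varAt α q),
      w[prefixLength α U (q - 1) + i]? = (σ (varAt α q))[i]? := by
    intro q h1 h2 i hi
    rw [hUα _ (varAt_mem h1 h2)] at hi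
    have e : w = (α.take (q - 1)).flatMap σ ++ (σ (varAt α q) ++ (α.drop q).flatMap σ) := by
      have h3 : α = α.take (q - 1) ++ varAt α q :: α.drop q := by
        have h4 : varAt α q = α[q - 1] := by simp [varAt, show q - 1 < α.length by omega]
        conv_lhs => rw [← List.take_append_drop (q - 1) α,
          List.drop_eq_getElem_cons (i := q - 1) (by omega), show q - 1 + 1 = q by omega, ← h4]
      conv_lhs => rw [hw, h3, List.flatMap_append, List.flatMap_cons]
    rw [hP, e, List.getElem?_append_right (by omega), Nat.add_sub_cancel_left,
      List.getElem?_append_left hi]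
  refine ⟨U, fun x => min_le_right _ _, by rw [hP, List.take_length], ?_⟩
  intro l r hl hl' hr hr' hv i hi
  rw [hget l hl hl' i hi, hget r hr hr' i (hv ▸ hi), hv]

/-! ### The language of the canonical automaton -/

variable [DecidableEq A]

/-- The conditions that are verified by a task: the two compared factors of `w` agree, and the last
factor ends at the end of `w`. -/
def Task.Verified (α : List ℕ) (w : List A) (U : ℕ → ℕ) : Task → Prop
  | .compare l r => (∀ i < U (varAt α l),
      w[prefixLength α U (l - 1) + i]? = w[prefixLength α U (r - 1) + i]?) ∧
      (r = α.length → prefixLength α U r = w.length)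
  | _ => True

/-- As long as the right head is on the tape, a task moves the heads by complete factors and does
not get stuck unless the right head would leave the word or a comparison fails. -/
theorem perform_iff {U : ℕ → ℕ} {τ : Task} {s s' h' : ℕ × ℕ} (hτ : FactorStep α τ s s')
    (hs : prefixLength α U s.2 ≤ w.length) :
    Task.Perform α w U τ (prefixLength α U s.1 + 1, prefixLength α U s.2 + 1) h' ↔
      prefixLength α U s'.2 ≤ w.length ∧ τ.Verified α w U ∧
        h' = (prefixLength α U s'.1 + 1, prefixLength α U s'.2 + 1) := by
  unfold Task.Perform
  cases hτ with
  | @forthLeft q b hqb hb =>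
    have h1 := prefixLength_succ U (hqb.trans hb)
    have h2 := prefixLength_mono (α := α) U hqb hb
    simp only at hs
    simp only [Task.var, Task.Verified, Task.mayLeave, and_true, true_and]
    rw [trace_replicate_forthLeft _ (by omega) hs, h1]
    exact (and_iff_right hs).symm
  | @forthRight a q haq hq =>
    have h1 := prefixLength_succ U hq
    have h2 := prefixLength_mono (α := α) U haq (by omega)
    simp only at hs
    simp only [Task.var, Task.Verified, Task.mayLeave, and_true, true_and]
    rw [trace_replicate_forthRight _ h2 hs, h1]
  | @backLeft q b hqb hb =>
    have h1 := prefixLength_succ U (hqb.trans hb)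
    have h2 := prefixLength_mono (α := α) U hqb hb
    simp only at hs
    simp only [Task.var, Task.Verified, Task.mayLeave, and_true, true_and]
    rw [h1, trace_replicate_backLeft _ (by omega) hs]
    exact (and_iff_right hs).symm
  | @compare l r hlr hr hv =>
    simp only at hs
    have h1 := prefixLength_succ U (show l + 1 ≤ α.length by omega)
    have h2 := prefixLength_succ U hr
    have h3 := prefixLength_mono (α := α) U hlr.le (by omega)
    rw [← hv] at h2
    simp only [Task.var, Task.Verified, Nat.add_sub_cancel]
    rw [trace_replicate_compare _ h3 hs, ← h1, ← h2, and_assoc, and_assoc, and_assoc]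
    refine and_congr_right fun hle => and_congr_right fun _ => ?_
    rw [and_comm]
    refine and_congr_left fun hh => ?_
    rw [hh]
    simp only
    rcases hle.eq_or_lt with heq | hlt
    · rw [scanned_succ_of_ge heq.ge]
      simp [Task.mayLeave, heq]
    · rw [scanned_succ_of_lt hlt]
      simp [Task.mayLeave, hlt.ne]

theorem FactorStep.snd_le {τ : Task} {s s' : ℕ × ℕ} (h : FactorStep α τ s s') :
    s'.2 ≤ α.length := by
  cases h <;> assumption

/-- The heads are always between two factors when a task starts. -/
theorem verified_of_trace {U : ℕ → ℕ} {L : List Task} {s s' h' : ℕ × ℕ}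
    (hL : Trace (FactorStep α) L s s') (hs : prefixLength α U s.2 ≤ w.length)
    (h : Trace (Task.Perform α w U) L (prefixLength α U s.1 + 1, prefixLength α U s.2 + 1) h') :
    ∀ τ ∈ L, τ.Verified α w U := by
  induction L generalizing s with
  | nil => simp
  | cons τ L ih =>
    obtain ⟨s₁, h1, h2⟩ := hL
    obtain ⟨h₁, h3, h4⟩ := h
    obtain ⟨h5, h6, rfl⟩ := (perform_iff h1 hs).1 h3
    intro τ' hτ'
    rcases List.mem_cons.1 hτ' with rfl | hτ'
    · exact h6
    · exact ih h2 h5 h4 τ' hτ'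

/-- Conversely, if the factors fit into the word, then all tasks can be performed as soon as the
comparisons among them succeed. -/
theorem trace_of_verified {U : ℕ → ℕ} {L : List Task} {s s' : ℕ × ℕ}
    (hL : Trace (FactorStep α) L s s') (hα : prefixLength α U α.length ≤ w.length)
    (hs : s.2 ≤ α.length)
    (h : ∀ τ ∈ L, ∀ s s', FactorStep α τ s s' → τ.Verified α w U) :
    Trace (Task.Perform α w U) L (prefixLength α U s.1 + 1, prefixLength α U s.2 + 1)
      (prefixLength α U s'.1 + 1, prefixLength α U s'.2 + 1) := by
  have hle : ∀ j ≤ α.length, prefixLength α U j ≤ w.length := fun j hj =>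
    (prefixLength_mono (α := α) U hj le_rfl).trans hα
  induction L generalizing s with
  | nil =>
    have : s = s' := hL
    rw [this]
    rfl
  | cons τ L ih =>
    obtain ⟨s₁, h1, h2⟩ := hL
    exact ⟨_, (perform_iff h1 (hle _ hs)).2 ⟨hle _ h1.snd_le, h τ (by simp) _ _ h1, rfl⟩,
      ih h2 h1.snd_le fun τ' hτ' => h τ' (by simp [hτ'])⟩

theorem language_automatonOf_canonical (hne : α ≠ []) (hα : ∀ x ∈ α, 2 ≤ α.count x) {k : ℕ}
    {co : ℕ → Fin k} (hco : IsCounterAssignment α (canonicalMode α) co) :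
    (automatonOf A α (canonicalMatching α) (canonicalMode α) co).language =
      patternLanguage A α := by
  obtain ⟨s, hs⟩ := trace_canonicalMode α
  have h0 : ∀ U, prefixLength α U 0 = 0 := fun U => by simp [prefixLength]
  ext w
  rw [mem_language_automatonOf_iff (hco.isConflictFree (isOperatingMode_canonical α))]
  constructor
  · rintro ⟨U, -, h', htr⟩
    have hver := verified_of_trace (U := U) (w := w) hs (by rw [h0]; exact Nat.zero_le _)
      (by simpa only [h0] using htr)
    have hcmp : ∀ m ∈ canonicalMatching α, (Task.compare m.1 m.2).Verified α w U :=
      fun m hm => hver _ (compare_mem_tasks hm)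
    refine mem_patternLanguage_of_factors (U := U) ?_ fun m hm => (hcmp m hm).1
    -- The last position of the pattern is not the first occurrence of its variable.
    have hpos : 0 < α.length := List.length_pos_iff.2 hne
    have h2 := hα (varAt α α.length) (varAt_mem hpos le_rfl)
    rw [count_eq_card] at h2
    obtain ⟨q, hq, hqne⟩ := Finset.exists_mem_ne h2 α.length
    simp only [Finset.mem_filter, Finset.mem_Icc] at hq
    have h3 := le_prevOcc hq.1.1 (show q < α.length by omega) hq.2
    exact (hcmp (prevOcc α α.length, α.length) (mem_canonicalMatching.2
      ⟨le_rfl, rfl, by simp only; omega, prevOcc_lt hpos⟩)).2 rfl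
  · intro hw
    obtain ⟨U, hU, hlen, hmatch⟩ := exists_verified_of_mem_patternLanguage hw
    refine ⟨U, hU, (prefixLength α U s.1 + 1, prefixLength α U s.2 + 1), ?_⟩
    have := trace_of_verified (w := w) hs hlen.le (Nat.zero_le _) fun τ _ s₁ s₂ hstep => ?_
    · rw [h0] at this
      exact this
    cases hstep with
    | forthLeft => trivial
    | forthRight => trivial
    | backLeft => trivial
    | @compare l r hlr hr hv =>
      exact ⟨hmatch _ _ (by omega) (by omega) (by omega) hr hv, fun e => by rw [e, hlen]⟩

end

/-! ### Patterns with a variable that occurs only once -/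

theorem patternLanguage_eq_univ (A : Type*) {α : List ℕ} {x : ℕ} (hx : α.count x = 1) :
    patternLanguage A α = Set.univ := by
  refine Set.eq_univ_of_forall fun w => ⟨fun y => if y = x then w else [], ?_⟩
  obtain ⟨s, t, rfl⟩ := List.append_of_mem (List.count_pos_iff.1 (by omega : 0 < α.count x))
  simp only [List.count_append, List.count_cons_self] at hx
  have hs : x ∉ s := List.count_eq_zero.1 (by omega)
  have ht : x ∉ t := List.count_eq_zero.1 (by omega)
  have hnil : ∀ L : List ℕ, x ∉ L → (L.flatMap fun y => if y = x then w else []) = [] := by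
    intro L hL
    rw [List.flatMap_eq_nil_iff]
    exact fun y hy => if_neg fun e : y = x => hL (e ▸ hy)
  rw [List.flatMap_append, List.flatMap_cons, hnil s hs, hnil t ht]
  simp

/-- An automaton that accepts every word immediately. -/
def trivialAutomaton (A : Type*) (k : ℕ) : Automaton A k where
  Q := Unit
  finite_Q := inferInstance
  start := ()
  accept := Set.univ
  δ := fun _ _ _ _ => ⟨(), 0, 0, fun _ => .keep⟩

theorem language_trivialAutomaton (A : Type*) (k : ℕ) :
    (trivialAutomaton A k).language = Set.univ :=
  Set.eq_univ_of_forall fun _ => ⟨_, Relation.ReflTransGen.refl, Set.mem_univ _⟩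

end Janus

theorem mainTheorem2 {A : Type*} [Finite A] [Nonempty A] [DecidableEq A]
    (α : List ℕ) (hα : α ≠ []) :
    (∃ M : Janus.Automaton A (Janus.variableDistance α + 1),
      M.language = Janus.patternLanguage A α) ∧
    ((∀ x ∈ α, 2 ≤ α.count x) →
      (∀ ms Δ, Janus.IsOperatingMode α ms Δ →
        Janus.variableDistance α ≤ Janus.counterNumber α Δ) ∧
      ∃ M : Janus.Automaton A (Janus.variableDistance α + 1),
        M.language = Janus.patternLanguage A α ∧
        (∃ ms Δ, Janus.IsOperatingMode α ms Δ ∧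
          Janus.counterNumber α Δ = Janus.variableDistance α ∧ M.IsObtainedFrom α ms Δ) ∧
        ∀ (k : ℕ) (M' : Janus.Automaton A k),
          (∃ ms Δ, Janus.IsOperatingMode α ms Δ ∧ M'.IsObtainedFrom α ms Δ) →
          Janus.variableDistance α + 1 ≤ k) := by
  have main : (∀ x ∈ α, 2 ≤ α.count x) → ∃ M : Janus.Automaton A (Janus.variableDistance α + 1),
      M.language = Janus.patternLanguage A α ∧
      ∃ ms Δ, Janus.IsOperatingMode α ms Δ ∧
        Janus.counterNumber α Δ = Janus.variableDistance α ∧ M.IsObtainedFrom α ms Δ := by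
    intro h2
    have hle := Janus.counterNumber_canonical_le h2
    have hΔ := Janus.isOperatingMode_canonical α
    obtain ⟨co, hco⟩ := Janus.exists_counterAssignment α (Janus.canonicalMode α) hle
    exact ⟨_, Janus.language_automatonOf_canonical hα h2 hco, _, _, hΔ,
      le_antisymm hle (hΔ.variableDistance_le_counterNumber h2), co, hco, rfl⟩
  refine ⟨?_, fun h2 => ⟨fun ms Δ hΔ => hΔ.variableDistance_le_counterNumber h2, ?_⟩⟩
  · by_cases h2 : ∀ x ∈ α, 2 ≤ α.count x
    · obtain ⟨M, hM, -⟩ := main h2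
      exact ⟨M, hM⟩
    · push Not at h2
      obtain ⟨x, hx, hlt⟩ := h2
      have hpos := List.count_pos_iff.2 hx
      refine ⟨Janus.trivialAutomaton A _, ?_⟩
      rw [Janus.language_trivialAutomaton,
        Janus.patternLanguage_eq_univ A (x := x) (by omega)]
  · obtain ⟨M, hM, hobt⟩ := main h2
    refine ⟨M, hM, hobt, ?_⟩
    rintro k M' ⟨ms, Δ, hΔ, co, hco, -⟩
    exact (Nat.succ_le_succ (hΔ.variableDistance_le_counterNumber h2)).trans
      hco.counterNumber_lt
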